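/- **Setting.** Consider a discounted MDP with $X$ states, $A$ actions, transition probabilities $P$, costs $c(x,a)\in[c_{\min},c_{\max}]$, initial distribution $\alpha$ and discount factor $\gamma\in(0,1)$; put $C=\max(|c_{\min}|,|c_{\max}|)$. For a stationary policy $\pi$ let $P_\pi$, $c_\pi$ be the induced transition matrix and cost vector, $J(\pi)=(1-\gamma)\,\alpha^\top\sum_{t\ge 0}\gamma^tP_\pi^t c_\pi$ the normalized expected discounted cost, $\nu_\pi^\top=(1-\gamma)\,\alpha^\top\sum_{t\ge0}\gamma^tP_\pi^t$, and $\mu_\pi(x,a)=\nu_\pi(x)\pi(a|x)$ the state-action occupancy measure. Let $\pi_1,\dots,\pi_m$ ($m\ge1$) be base policies. For $w$ in the simplex $\Delta_m$ let $\pi_w=\sum_i w_i\pi_i$, and let $\pi_*=\pi_{w^*}$ with $w^*$ a minimizer of $J(\pi_w)$ over $\Delta_m$. Let $\Theta=\{\theta\in\mathbb R^m:\sum_i\theta_i=1,\ \|\theta\|_2\le S\}$, assumed non-empty, $\xi_\theta=\sum_i\theta_i\mu_{\pi_i}$, $U(\theta)=\sum_{x,a}|\min(\xi_\theta(x,a),0)|$,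 and let $\pi_\theta(a|x)=[\xi_\theta(x,a)]_+/\sum_{a'}[\xi_\theta(x,a')]_+$ (uniform in $a$ if $\xi_\theta(x,\cdot)\le0$). **Algorithm** (parameters $\eta>0$ and $T\ge 1$). Compute $\mu_{\pi_1},\dots,\mu_{\pi_m}$. Put $H=1/\eta$, $\theta_1=0$. For $t=1,\dots,T$: draw $i\in\{1,\dots,m\}$ uniformly and $(x_t,a_t)\sim\mu_{\pi_i}$, independently of the past; let $g_t$ be the vector with entries $$(g_t)_j=\mu_{\pi_j}^\top c-H\,\frac{m\,\mu_{\pi_j}(x_t,a_t)}{\sum_i\mu_{\pi_i}(x_t,a_t)}\,\mathbf 1\{\xi_{\theta_t}(x_t,a_t)<0\},$$ and let $\theta_{t+1}$ be the Euclidean projection onto $\Theta$ of $\theta_t-\frac{S}{(\sqrt m+Hm)\sqrt T}\,g_t$. Return $\pi_{\hat\theta}$ with $\hat\theta=\frac1T\sum_{t=1}^T\theta_t$. For $\delta\in(0,1)$, call $T$ sufficient for $(\eta,\delta)$ if $T\ge \frac{S^2}{\eta^4}\bigl(1+\log\frac1\delta\bigr)$. **Theorem.** There is a polynomial $K=K(S,m,C)$,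 the same for all MDPs, base policies and parameters, such that, with $$\Phi(\theta)=\sum_{i=1}^m\theta_i(\mu_{\pi_i}-\mu_{\pi_*})^\top c+K\Bigl(\frac{U(\theta)}{1-\gamma}\vee\sqrt{\frac{U(\theta)}{1-\gamma}}\Bigr),$$ the minima $\min_{w\in\Delta_m}J(\pi_w)$ and $\min_{\theta\in\Theta}\Phi(\theta)$ are attained, and the following hold. 1. Let $u>0$, $\eta=\sqrt{(1-\gamma)u}$, and let $T$ be sufficient for $(\eta,\delta)$. With probability at least $1-\delta$, simultaneously for all $\theta\in\Theta$ with $U(\theta)\le u$, $$J(\pi_{\hat\theta})\le\min_{w\in\Delta_m}J(\pi_w)+\sum_{i=1}^m\theta_i(\mu_{\pi_i}-\mu_{\pi_*})^\top c+K\Bigl(\frac{u}{1-\gamma}\vee\sqrt{\frac{u}{1-\gamma}}\Bigr).$$ In particular, if a minimizer $\theta^\circ$ of $\Phi$ over $\Theta$ has $U(\theta^\circ)>0$, then the choice $u=U(\theta^\circ)$ gives $J(\pi_{\hat\theta})\le\min_{w}J(\pi_w)+\min_{\theta\in\Theta}\Phi(\theta)$ with probability at least $1-\delta$. 2. In every case,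 for each $\varepsilon>0$ there is $\eta>0$ such that, for all $\delta\in(0,1)$ and all $T$ sufficient for $(\eta,\delta)$, with probability at least $1-\delta$, $$J(\pi_{\hat\theta})\le\min_{w\in\Delta_m}J(\pi_w)+\min_{\theta\in\Theta}\Phi(\theta)+\varepsilon .$$ 3. There are polynomials $p,q$ such that the algorithm, with the occupancy measures computed exactly by Gauss–Jordan elimination, always runs in at most $p(X)\,A\,q(m)\,T$ steps, hence in $O(\mathrm{poly}(X)\,A)$ steps for fixed $m$ and $T$. A step is an arithmetic operation, square root or comparison of real numbers, a table write, a loop iteration or a uniform draw from a finite set; a draw from a stored probability vector of length $n$ counts as $n$ steps. -/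

import Mathlib

namespace DualMDP

noncomputable section

/-! ## Discounted Markov decision processes -/

/-- A finite discounted MDP with `X` states and `A` actions. -/
structure MDP (X A : ℕ) where
  /-- transition probabilities: `P x a y` is the probability of moving from `x` to `y` under `a` -/
  P : Fin X → Fin A → Fin X → ℝ
  P_mem : ∀ x a, P x a ∈ stdSimplex ℝ (Fin X)
  /-- cost function, with values in `[cMin, cMax]` -/
  c : Fin X → Fin A → ℝ
  cMin : ℝ
  cMax : ℝ
  c_mem : ∀ x a, c x a ∈ Set.Icc cMin cMax
  /-- initial distribution -/
  α : Fin X → ℝ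
  α_mem : α ∈ stdSimplex ℝ (Fin X)
  /-- discount factor -/
  γ : ℝ
  γ_mem : γ ∈ Set.Ioo (0 : ℝ) 1

/-- A stationary randomized policy. -/
structure Policy (X A : ℕ) where
  prob : Fin X → Fin A → ℝ
  prob_mem : ∀ x, prob x ∈ stdSimplex ℝ (Fin A)

variable {X A m : ℕ}

/-- The bound `max(|cMin|, |cMax|)` on the absolute value of the costs. -/
def MDP.costBound (M : MDP X A) : ℝ := max |M.cMin| |M.cMax|

/-- The transition matrix `P_π` of the Markov chain induced by a policy. -/
def MDP.chain (M : MDP X A) (p : Policy X A) : Matrix (Fin X) (Fin X) ℝ :=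
  Matrix.of fun x y => ∑ a, p.prob x a * M.P x a y

/-- The cost function `c_π` of the Markov chain induced by a policy. -/
def MDP.chainCost (M : MDP X A) (p : Policy X A) : Fin X → ℝ :=
  fun x => ∑ a, p.prob x a * M.c x a

/-- The (normalized) value function
`J_π(x) = (1-γ) E[∑_t γ^t c(x_t, a_t) | x_0 = x]`. -/
def MDP.value (M : MDP X A) (p : Policy X A) (x : Fin X) : ℝ :=
  (1 - M.γ) * ∑' t : ℕ, M.γ ^ t * ((M.chain p ^ t).mulVec (M.chainCost p)) x

/-- `J(π) = αᵀ J_π`. -/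
def MDP.J (M : MDP X A) (p : Policy X A) : ℝ := ∑ x, M.α x * M.value p x

/-- The state occupancy measure
`ν_π(x) = (1-γ) ∑_{x'} α(x') ∑_t γ^t ℙ(X_t = x | X_0 = x')`. -/
def MDP.stateOcc (M : MDP X A) (p : Policy X A) (x : Fin X) : ℝ :=
  (1 - M.γ) * ∑ x', M.α x' * ∑' t : ℕ, M.γ ^ t * (M.chain p ^ t) x' x

/-- The state-action occupancy measure `μ_π(x,a) = ν_π(x) π(a|x)`. -/
def MDP.occ (M : MDP X A) (p : Policy X A) (x : Fin X) (a : Fin A) : ℝ :=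
  M.stateOcc p x * p.prob x a

/-! ## The primal space of mixtures -/

/-- The mixture policy `π_w = ∑_i w_i π_i`. -/
def mixture (π : Fin m → Policy X A) (w : stdSimplex ℝ (Fin m)) : Policy X A where
  prob x a := ∑ i, w.1 i * (π i).prob x a
  prob_mem x := by
    refine ⟨fun a => Finset.sum_nonneg fun i _ =>
      mul_nonneg (w.2.1 i) (((π i).prob_mem x).1 a), ?_⟩
    rw [Finset.sum_comm]
    simp_rw [← Finset.mul_sum, ((π _).prob_mem x).2, mul_one]
    exact w.2.2

/-- `w` attains `min_{w ∈ Δ_m} J(π_w)`. -/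
def IsOptimalMixture (M : MDP X A) (π : Fin m → Policy X A) (w : stdSimplex ℝ (Fin m)) : Prop :=
  ∀ w' : stdSimplex ℝ (Fin m), M.J (mixture π w) ≤ M.J (mixture π w')

/-! ## The dual space -/

/-- `Θ = {θ ∈ ℝ^m : ∑_i θ_i = 1, ‖θ‖₂ ≤ S}`. -/
def Theta (m : ℕ) (S : ℝ) : Set (EuclideanSpace ℝ (Fin m)) :=
  {θ | ∑ i, θ i = 1 ∧ ‖θ‖ ≤ S}

/-- `ξ_θ = ∑_i θ_i μ_{π_i}`. -/
def MDP.xi (M : MDP X A) (π : Fin m → Policy X A) (θ : EuclideanSpace ℝ (Fin m))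
    (x : Fin X) (a : Fin A) : ℝ :=
  ∑ i, θ i * M.occ (π i) x a

/-- The policy obtained by normalizing the positive part of each row of a table; a row without
positive entries gives the uniform distribution. -/
def normalizePos [NeZero A] (ξ : Fin X → Fin A → ℝ) : Policy X A where
  prob x a :=
    if ∀ a', ξ x a' ≤ 0 then 1 / (A : ℝ) else max (ξ x a) 0 / ∑ a', max (ξ x a') 0
  prob_mem x := by
    by_cases h : ∀ a', ξ x a' ≤ 0
    · have hA : (A : ℝ) ≠ 0 := Nat.cast_ne_zero.2 (NeZero.ne A)
      simp only [h, implies_true, if_true]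
      refine ⟨fun a => by positivity, ?_⟩
      simp [hA]
    · simp only [h, if_false]
      have hpos : 0 < ∑ a', max (ξ x a') 0 := by
        push Not at h
        obtain ⟨a, ha⟩ := h
        exact Finset.sum_pos' (fun i _ => le_max_right _ _)
          ⟨a, Finset.mem_univ a, lt_max_of_lt_left ha⟩
      refine ⟨fun a => div_nonneg (le_max_right _ _) hpos.le, ?_⟩
      rw [← Finset.sum_div, div_self hpos.ne']

/-- The policy `π_θ(a|x) = [ξ_θ(x,a)]₊ / ∑_{a'} [ξ_θ(x,a')]₊`. -/
def MDP.dualPolicy [NeZero A] (M : MDP X A) (π : Fin m → Policy X A)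
    (θ : EuclideanSpace ℝ (Fin m)) : Policy X A :=
  normalizePos (M.xi π θ)

/-- The constraint violation `U(θ) = ∑_{(x,a)} |[ξ_θ(x,a)]₋|`, where `[v]₋ = min(v, 0)`. -/
def MDP.violation (M : MDP X A) (π : Fin m → Policy X A) (θ : EuclideanSpace ℝ (Fin m)) : ℝ :=
  ∑ x, ∑ a, |min (M.xi π θ x a) 0|

/-- `∑_i θ_i (μ_{π_i} - μ_{π_*})ᵀ c`, for `π_* = π_w`. -/
def MDP.dualGap (M : MDP X A) (π : Fin m → Policy X A) (w : stdSimplex ℝ (Fin m))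
    (θ : EuclideanSpace ℝ (Fin m)) : ℝ :=
  ∑ i, θ i * ∑ x, ∑ a, (M.occ (π i) x a - M.occ (mixture π w) x a) * M.c x a

/-- `u/(1-γ) ∨ √(u/(1-γ))`. -/
def MDP.rate (M : MDP X A) (u : ℝ) : ℝ := max (u / (1 - M.γ)) (Real.sqrt (u / (1 - M.γ)))

/-! ## The stochastic subgradient method -/

/-- The law on `ι` with weights `p` (the uniform law if `p` is not a probability vector). -/
def discreteLaw {ι : Type} [Fintype ι] [Nonempty ι] (p : ι → ℝ) : PMF ι :=
  if h : ∑ i, ENNReal.ofReal (p i) = 1 then PMF.ofFintype (fun i => ENNReal.ofReal (p i)) h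
  else PMF.uniformOfFintype ι

/-- One sample: `i` uniform on the base policies, then `(x,a) ∼ μ_{π_i}`. -/
def MDP.sampleLaw [NeZero X] [NeZero A] [NeZero m] (M : MDP X A) (π : Fin m → Policy X A) :
    PMF (Fin X × Fin A) :=
  (PMF.uniformOfFintype (Fin m)).bind fun i =>
    discreteLaw fun xa : Fin X × Fin A => M.occ (π i) xa.1 xa.2

/-- The Euclidean projection onto `Θ`: the point of `Θ` nearest to `y`. -/
def projTheta (S : ℝ) (y : EuclideanSpace ℝ (Fin m)) : EuclideanSpace ℝ (Fin m) :=
  Classical.epsilon fun p => p ∈ Theta m S ∧ ∀ q ∈ Theta m S, dist y p ≤ dist y q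

/-- The subgradient estimate
`g(θ) = cᵀM - H (m M(x,a) / ∑_i μ_{π_i}(x,a)) 1{ξ_θ(x,a) < 0}`, `M` having columns `μ_{π_j}`. -/
def MDP.subgrad (M : MDP X A) (π : Fin m → Policy X A) (H : ℝ)
    (θ : EuclideanSpace ℝ (Fin m)) (xa : Fin X × Fin A) : EuclideanSpace ℝ (Fin m) :=
  WithLp.toLp 2 fun j =>
    (∑ x, ∑ a, M.c x a * M.occ (π j) x a) -
      H * (m * M.occ (π j) xa.1 xa.2 / ∑ i, M.occ (π i) xa.1 xa.2) *
        (if M.xi π θ xa.1 xa.2 < 0 then 1 else 0)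

/-- The learning rate `S / (G' √T)` with `G' = √m + H m`, for `H = 1/η`. -/
def learningRate (m : ℕ) (S η : ℝ) (T : ℕ) : ℝ :=
  S / ((Real.sqrt m + 1 / η * m) * Real.sqrt T)

/-- The joint law of `(θ_{t+1}, θ_1 + ⋯ + θ_t)` after `t` rounds, started from `θ_1 = 0`, with
constant learning rate `ρ`. -/
def MDP.sgdRounds [NeZero X] [NeZero A] [NeZero m] (M : MDP X A) (π : Fin m → Policy X A)
    (S H ρ : ℝ) : ℕ → PMF (EuclideanSpace ℝ (Fin m) × EuclideanSpace ℝ (Fin m))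
  | 0 => PMF.pure (0, 0)
  | t + 1 => (M.sgdRounds π S H ρ t).bind fun s =>
      (M.sampleLaw π).map fun xa =>
        (projTheta S (s.1 - ρ • M.subgrad π H s.1 xa), s.2 + s.1)

/-- The law of the output `θ̂ = (1/T) ∑_{t=1}^T θ_t` of the stochastic subgradient method with `T`
rounds, multiplier `H = 1/η` and learning rates `S/(G'√T)`. -/
def MDP.dualSGD [NeZero X] [NeZero A] [NeZero m] (M : MDP X A) (π : Fin m → Policy X A)
    (S η : ℝ) (T : ℕ) : PMF (EuclideanSpace ℝ (Fin m)) :=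
  (M.sgdRounds π S (1 / η) (learningRate m S η T) T).map fun s => (1 / (T : ℝ)) • s.2

/-- The method has enough rounds for accuracy `η` and confidence `1 - δ`:
`T ≥ (S²/η⁴) (1 + log (1/δ))`. -/
def EnoughRounds (S η δ : ℝ) (T : ℕ) : Prop :=
  S ^ 2 / η ^ 4 * (1 + Real.log (1 / δ)) ≤ T

/-! ## A real-arithmetic program with a step count

Every arithmetic operation, square root, comparison, table write, loop iteration and random draw
from a finite uniform law counts as one step; a draw from a stored probability vector of length `n`
counts `n` steps. -/

/-- A value together with the number of steps spent on computing it. -/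
structure Timed (β : Type) where
  val : β
  steps : ℕ

namespace Timed

instance : Monad Timed where
  pure b := ⟨b, 0⟩
  bind x f := ⟨(f x.val).val, x.steps + (f x.val).steps⟩

def tick : Timed Unit := ⟨(), 1⟩
def nat (n : ℕ) : Timed ℝ := ⟨n, 1⟩
def add (x y : ℝ) : Timed ℝ := ⟨x + y, 1⟩
def sub (x y : ℝ) : Timed ℝ := ⟨x - y, 1⟩
def mul (x y : ℝ) : Timed ℝ := ⟨x * y, 1⟩
def div (x y : ℝ) : Timed ℝ := ⟨x / y, 1⟩
def sqrt (x : ℝ) : Timed ℝ := ⟨Real.sqrt x, 1⟩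
def lt (x y : ℝ) : Timed Bool := ⟨decide (x < y), 1⟩

/-- Evaluate all entries of a table and store them, one write per entry. -/
def tabulate {β : Type} {n : ℕ} (f : Fin n → Timed β) : Timed (Fin n → β) :=
  ⟨fun i => (f i).val, ∑ i, ((f i).steps + 1)⟩

/-- Evaluate all summands and add them up, one addition per summand. -/
def sum {n : ℕ} (f : Fin n → Timed ℝ) : Timed ℝ :=
  ⟨∑ i, (f i).val, ∑ i, ((f i).steps + 1)⟩

/-- `for k = 0, …, n-1 do s := body k s`. -/
def loop {σ : Type} (n : ℕ) (body : Fin n → σ → Timed σ) (s : σ) : Timed σ :=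
  (List.finRange n).foldlM (fun s k => do tick; body k s) s

end Timed

open Timed

/-- One step of Gauss-Jordan elimination, with pivot `(k,k)`, on an `n × (n+1)` matrix. -/
def eliminate {n : ℕ} (k : Fin n) (B : Fin n → Fin (n + 1) → ℝ) :
    Timed (Fin n → Fin (n + 1) → ℝ) :=
  tabulate fun i => tabulate fun j => do
    tick
    if i = k then div (B k j) (B k k.castSucc)
    else do
      let q ← div (B i k.castSucc) (B k k.castSucc)
      let r ← mul q (B k j)
      sub (B i j) r

/-- Solve the linear system with augmented matrix `B` by Gauss-Jordan elimination. -/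
def solve {n : ℕ} (B : Fin n → Fin (n + 1) → ℝ) : Timed (Fin n → ℝ) := do
  let R ← loop n eliminate B
  tabulate fun i => pure (R i (Fin.last n))

/-- Compute `μ_π`, from the linear system `ν(y) - γ ∑_x P_π(x,y) ν(x) = (1-γ) α(y)`. -/
def progOcc (M : MDP X A) (p : Policy X A) : Timed (Fin X → Fin A → ℝ) := do
  let Q ← tabulate fun x => tabulate fun y => Timed.sum fun a => mul (p.prob x a) (M.P x a y)
  let B ← tabulate fun y => tabulate fun j : Fin (X + 1) => do
    tick
    if h : j.val < X then do
      let r ← mul M.γ (Q ⟨j.val, h⟩ y)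
      let one ← nat (if y.val = j.val then 1 else 0)
      sub one r
    else do
      let one ← nat 1
      let d ← sub one M.γ
      mul d (M.α y)
  let ν ← solve B
  tabulate fun x => tabulate fun a => mul (ν x) (p.prob x a)

/-- Compute the Euclidean projection onto `Θ`: project onto the hyperplane `∑_i θ_i = 1` and, if
necessary, shrink towards its centre `(1/m, …, 1/m)`. -/
def progProj (S : ℝ) (y : Fin m → ℝ) : Timed (Fin m → ℝ) := do
  let m' ← nat m
  let one ← nat 1
  let inv ← div one m'
  let s ← Timed.sum fun i => pure (y i)
  let e ← sub one s
  let shift ← div e m'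
  let z ← tabulate fun i => add (y i) shift
  let d ← tabulate fun i => sub (z i) inv
  let n2 ← Timed.sum fun i => mul (d i) (d i)
  let s2 ← mul S S
  let r2 ← sub s2 inv
  if ← lt r2 n2 then do
    let q ← div r2 n2
    let f ← sqrt q
    tabulate fun i => do
      let v ← mul f (d i)
      add inv v
  else pure z

/-- Compute the subgradient estimate at `θ` from the stored occupancy measures `occ`, the stored
vector `cM = cᵀM` and the sample `(x,a)`. -/
def progSubgrad (occ : Fin m → Fin X → Fin A → ℝ) (cM : Fin m → ℝ) (H : ℝ) (θ : Fin m → ℝ)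
    (x : Fin X) (a : Fin A) : Timed (Fin m → ℝ) := do
  let ξ ← Timed.sum fun i => mul (θ i) (occ i x a)
  let zero ← nat 0
  if ← lt ξ zero then do
    let m' ← nat m
    let tot ← Timed.sum fun i => pure (occ i x a)
    tabulate fun j => do
      let u ← mul m' (occ j x a)
      let v ← div u tot
      let r ← mul H v
      sub (cM j) r
  else tabulate fun j => pure (cM j)

/-- Compute the policy `π_θ` from the stored occupancy measures. -/
def progPolicy (occ : Fin m → Fin X → Fin A → ℝ) (θ : Fin m → ℝ) :
    Timed (Fin X → Fin A → ℝ) :=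
  tabulate fun x => do
    let zero ← nat 0
    let pos ← tabulate fun a => do
      let ξ ← Timed.sum fun i => mul (θ i) (occ i x a)
      if ← lt zero ξ then pure ξ else pure zero
    let tot ← Timed.sum fun a => pure (pos a)
    if ← lt zero tot then tabulate fun a => div (pos a) tot
    else do
      let A' ← nat A
      let one ← nat 1
      tabulate fun _ => div one A'

/-- A randomized program: the law of its result and of its number of steps. -/
def Prog (β : Type) : Type := PMF (Timed β)

namespace Prog

instance : Monad Prog where
  pure b := PMF.pure ⟨b, 0⟩
  bind x f := PMF.bind x fun r =>
    PMF.map (fun r' : Timed _ => ⟨r'.val, r.steps + r'.steps⟩) (f r.val)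

/-- Run a deterministic program. -/
def det {β : Type} (t : Timed β) : Prog β := PMF.pure t

/-- Draw an index uniformly, in one step. -/
def drawUniform (n : ℕ) [NeZero n] : Prog (Fin n) :=
  PMF.map (fun i => ⟨i, 1⟩) (PMF.uniformOfFintype (Fin n))

/-- Draw from a stored `X × A` table of probabilities, in `X * A` steps. -/
def drawTable [NeZero X] [NeZero A] (p : Fin X → Fin A → ℝ) : Prog (Fin X × Fin A) :=
  PMF.map (fun xa => ⟨xa, X * A⟩) (discreteLaw fun xa : Fin X × Fin A => p xa.1 xa.2)

end Prog

/-- `t` rounds of the main loop, from `θ_1 = 0`; the state consists of the current parameter and the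
sum of the earlier ones. -/
def progRounds [NeZero X] [NeZero A] [NeZero m] (occ : Fin m → Fin X → Fin A → ℝ)
    (cM : Fin m → ℝ) (S H ρ : ℝ) : ℕ → Prog ((Fin m → ℝ) × (Fin m → ℝ))
  | 0 => Prog.det do
      let z ← tabulate fun _ => nat 0
      let s ← tabulate fun _ => nat 0
      pure (z, s)
  | t + 1 => do
      let st ← progRounds occ cM S H ρ t
      let i ← Prog.drawUniform m
      let xa ← Prog.drawTable (occ i)
      Prog.det do
        tick
        let g ← progSubgrad occ cM H st.1 xa.1 xa.2
        let y ← tabulate fun j => do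
          let r ← mul ρ (g j)
          sub (st.1 j) r
        let θ ← progProj S y
        let s ← tabulate fun j => add (st.2 j) (st.1 j)
        pure (θ, s)

/-- The whole algorithm: occupancy measures, parameters, `T` rounds, averaging, and the table of the
resulting policy. The result is the pair `(θ̂, π_θ̂)`. -/
def program [NeZero X] [NeZero A] [NeZero m] (M : MDP X A) (π : Fin m → Policy X A)
    (S η : ℝ) (T : ℕ) : Prog ((Fin m → ℝ) × (Fin X → Fin A → ℝ)) := do
  let occ ← Prog.det (tabulate fun i => progOcc M (π i))
  let cM ← Prog.det (tabulate fun j =>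
    Timed.sum fun x => Timed.sum fun a => mul (M.c x a) (occ j x a))
  let T' ← Prog.det (nat T)
  let H ← Prog.det do
    let one ← nat 1
    div one η
  let ρ ← Prog.det do
    let m' ← nat m
    let a ← sqrt m'
    let b ← mul H m'
    let G ← add a b
    let r ← sqrt T'
    let q ← mul G r
    div S q
  let st ← progRounds occ cM S H ρ T
  let θ ← Prog.det (tabulate fun j => div (st.2 j) T')
  let p ← Prog.det (progPolicy occ θ)
  pure (θ, p)

end

end DualMDP

/-!
The proof has three parts: a deterministic comparison of the cost of `π_θ` with the linear cost
`cᵀ ξ_θ`, a high-probability regret bound for the stochastic subgradient method, and the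
verification of the program.

*Comparison.* If `∑ᵢ θᵢ = 1`, then `ξ_θ` satisfies the flow equation of occupancy measures. Its
positive part is the product of its state marginal `ζ` with `π_θ`, so `ζ` satisfies the flow
equation of `π_θ` up to an error `e` whose `ℓ¹`-norm is at most `2 U(θ)`. Pairing with the Bellman
equation of `π_θ` turns this into `|J(π_θ) - cᵀ ξ_θ| ≤ 3 C U(θ) / (1-γ)`
(`MDP.abs_J_dualPolicy_sub_le`). As the starting point `0` is not in `Θ`, the average iterate has
total weight `1 - 1/T` only, which costs another `C/T`.

*Regret.* The penalized cost `L(θ) = cᵀ ξ_θ + H U(θ)` is sublinear, so that `T L(θ̂)` is `L` of the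
sum of the iterates and the pair (current iterate, sum of the earlier ones) suffices to run the
argument. The potential `L(∑ θₛ) - t L(q) + ‖θₜ - q‖² / (2ρ)` grows in each round at most by a
constant plus a bounded noise of mean zero (`MDP.potential_step_le`); Hoeffding's lemma bounds its
exponential moment and Markov's inequality its tail (`MDP.toOuterMeasure_sgdRounds_le`). A single
comparator `q` is enough: the best parameter with violation at most `u` is deterministic, and the
bound for it implies the bound for all the others. With `H = 1/η` the penalty forces the violation
of `θ̂` down to order `u + η`, and `η = √((1-γ)u)` balances the terms
(`cost_le_of_penalized_le`). For `η > 1` the rate exceeds one and the bound is trivial.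

*Program.* The matrix `I - γ P_πᵀ` has non-positive off-diagonal entries and positive column sums.
Gauss-Jordan elimination preserves these properties on the block that remains, so no pivot vanishes
(`EliminationInvariant.eliminate`). The projection onto `Θ` is the explicit shrinking towards the
centre of the hyperplane, by the variational inequality (`projTheta_eq`). Step counts add up.
-/

namespace DualMDP

noncomputable section

variable {X A m : ℕ}

/-! ### Occupancy measures and values -/

/-- The absolute value of a weighted average of numbers of absolute value at most `C` is at
most `C`. -/
lemma abs_sum_mul_le {ι : Type*} [Fintype ι] {p f : ι → ℝ} {C : ℝ} (hp : p ∈ stdSimplex ℝ ι)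
    (hf : ∀ i, |f i| ≤ C) : |∑ i, p i * f i| ≤ C := by
  calc |∑ i, p i * f i| ≤ ∑ i, |p i * f i| := Finset.abs_sum_le_sum_abs _ _
    _ ≤ ∑ i, p i * C := Finset.sum_le_sum fun i _ => by
        rw [abs_mul, abs_of_nonneg (hp.1 i)]
        exact mul_le_mul_of_nonneg_left (hf i) (hp.1 i)
    _ = C := by rw [← Finset.sum_mul, hp.2, one_mul]

lemma MDP.γ_nonneg (M : MDP X A) : 0 ≤ M.γ := M.γ_mem.1.le

lemma MDP.one_sub_γ_pos (M : MDP X A) : 0 < 1 - M.γ := sub_pos.2 M.γ_mem.2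

lemma MDP.abs_c_le (M : MDP X A) (x : Fin X) (a : Fin A) : |M.c x a| ≤ M.costBound :=
  abs_le_max_abs_abs (M.c_mem x a).1 (M.c_mem x a).2

lemma MDP.costBound_nonneg (M : MDP X A) : 0 ≤ M.costBound :=
  (abs_nonneg _).trans (le_max_left _ _)

lemma MDP.chain_mem (M : MDP X A) (p : Policy X A) :
    M.chain p ∈ Matrix.rowStochastic ℝ (Fin X) := by
  rw [Matrix.mem_rowStochastic_iff_sum]
  simp only [MDP.chain, Matrix.of_apply]
  refine ⟨fun x y => Finset.sum_nonneg fun a _ =>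
    mul_nonneg ((p.prob_mem x).1 a) ((M.P_mem x a).1 y), fun x => ?_⟩
  rw [Finset.sum_comm]
  simp_rw [← Finset.mul_sum, (M.P_mem x _).2, mul_one]
  exact (p.prob_mem x).2

lemma MDP.chain_pow_mem (M : MDP X A) (p : Policy X A) (t : ℕ) (x : Fin X) :
    (M.chain p ^ t) x ∈ stdSimplex ℝ (Fin X) := by
  have h := pow_mem (M.chain_mem p) t
  exact ⟨fun y => Matrix.nonneg_of_mem_rowStochastic h, Matrix.sum_row_of_mem_rowStochastic h x⟩

lemma MDP.abs_chainCost_le (M : MDP X A) (p : Policy X A) (x : Fin X) :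
    |M.chainCost p x| ≤ M.costBound :=
  abs_sum_mul_le (p.prob_mem x) fun a => M.abs_c_le x a

lemma MDP.abs_chain_pow_mulVec_le (M : MDP X A) (p : Policy X A) (t : ℕ) (x : Fin X) :
    |((M.chain p ^ t).mulVec (M.chainCost p)) x| ≤ M.costBound :=
  abs_sum_mul_le (M.chain_pow_mem p t x) (M.abs_chainCost_le p)

lemma MDP.hasSum_discount (M : MDP X A) : HasSum (fun t : ℕ => M.γ ^ t) (1 - M.γ)⁻¹ :=
  hasSum_geometric_of_lt_one M.γ_nonneg M.γ_mem.2

lemma MDP.norm_value_term_le (M : MDP X A) (p : Policy X A) (x : Fin X) (t : ℕ) :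
    ‖M.γ ^ t * ((M.chain p ^ t).mulVec (M.chainCost p)) x‖ ≤ M.γ ^ t * M.costBound := by
  rw [norm_mul, Real.norm_of_nonneg (pow_nonneg M.γ_nonneg t)]
  exact mul_le_mul_of_nonneg_left (M.abs_chain_pow_mulVec_le p t x) (pow_nonneg M.γ_nonneg t)

lemma MDP.summable_value (M : MDP X A) (p : Policy X A) (x : Fin X) :
    Summable fun t : ℕ => M.γ ^ t * ((M.chain p ^ t).mulVec (M.chainCost p)) x :=
  Summable.of_norm_bounded (M.hasSum_discount.summable.mul_right M.costBound)
    (M.norm_value_term_le p x)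

lemma MDP.summable_occ (M : MDP X A) (p : Policy X A) (x y : Fin X) :
    Summable fun t : ℕ => M.γ ^ t * (M.chain p ^ t) x y := by
  refine Summable.of_nonneg_of_le
    (fun t => mul_nonneg (pow_nonneg M.γ_nonneg t) ((M.chain_pow_mem p t x).1 y))
    (fun t => ?_) M.hasSum_discount.summable
  exact mul_le_of_le_one_right (pow_nonneg M.γ_nonneg t)
    (Matrix.le_one_of_mem_rowStochastic (pow_mem (M.chain_mem p) t))

lemma MDP.abs_value_le (M : MDP X A) (p : Policy X A) (x : Fin X) :
    |M.value p x| ≤ M.costBound := by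
  have h := tsum_of_norm_bounded (M.hasSum_discount.mul_right M.costBound)
    (M.norm_value_term_le p x)
  rw [Real.norm_eq_abs] at h
  rw [MDP.value, abs_mul, abs_of_pos M.one_sub_γ_pos]
  calc _ ≤ (1 - M.γ) * ((1 - M.γ)⁻¹ * M.costBound) :=
        mul_le_mul_of_nonneg_left h M.one_sub_γ_pos.le
    _ = M.costBound := by rw [mul_inv_cancel_left₀ M.one_sub_γ_pos.ne']

/-- The Bellman equation `V = (1-γ) c_π + γ P_π V`. -/
lemma MDP.value_eq (M : MDP X A) (p : Policy X A) (x : Fin X) :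
    M.value p x = (1 - M.γ) * M.chainCost p x + M.γ * ∑ y, M.chain p x y * M.value p y := by
  have h1 : ∑' t : ℕ, M.γ ^ t * ((M.chain p ^ t).mulVec (M.chainCost p)) x =
      M.chainCost p x + M.γ * ∑ y, M.chain p x y *
        ∑' t : ℕ, M.γ ^ t * ((M.chain p ^ t).mulVec (M.chainCost p)) y := by
    rw [(M.summable_value p x).tsum_eq_zero_add]
    simp_rw [← tsum_mul_left]
    rw [← Summable.tsum_finsetSum fun y _ => (M.summable_value p y).mul_left _, ← tsum_mul_left]
    congr 1
    · simp
    · refine tsum_congr fun t => ?_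
      rw [pow_succ' (M.chain p), ← Matrix.mulVec_mulVec, Matrix.mulVec, dotProduct, pow_succ,
        Finset.mul_sum, Finset.mul_sum]
      exact Finset.sum_congr rfl fun y _ => by ring
  rw [MDP.value, h1, mul_add]
  simp only [MDP.value, Finset.mul_sum]
  congr 1
  exact Finset.sum_congr rfl fun y _ => by ring

/-- The flow equation `ν = (1-γ) α + γ P_πᵀ ν`. -/
lemma MDP.stateOcc_eq (M : MDP X A) (p : Policy X A) (y : Fin X) :
    M.stateOcc p y = (1 - M.γ) * M.α y + M.γ * ∑ x, M.stateOcc p x * M.chain p x y := by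
  have h1 : ∀ z, ∑' t : ℕ, M.γ ^ t * (M.chain p ^ t) z y =
      (1 : Matrix (Fin X) (Fin X) ℝ) z y +
        M.γ * ∑ x, (∑' t : ℕ, M.γ ^ t * (M.chain p ^ t) z x) * M.chain p x y := by
    intro z
    rw [(M.summable_occ p z y).tsum_eq_zero_add]
    simp_rw [← tsum_mul_right]
    rw [← Summable.tsum_finsetSum fun x _ => (M.summable_occ p z x).mul_right _, ← tsum_mul_left]
    congr 1
    · simp
    · refine tsum_congr fun t => ?_
      rw [pow_succ (M.chain p), Matrix.mul_apply, pow_succ, Finset.mul_sum, Finset.mul_sum]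
      exact Finset.sum_congr rfl fun x _ => by ring
  have h2 : ∑ z, M.α z * ∑' t : ℕ, M.γ ^ t * (M.chain p ^ t) z y =
      M.α y + M.γ * ∑ x, (∑ z, M.α z * ∑' t : ℕ, M.γ ^ t * (M.chain p ^ t) z x) *
        M.chain p x y := by
    rw [Finset.sum_congr rfl fun z _ => by rw [h1 z]]
    simp_rw [mul_add, Finset.sum_add_distrib]
    congr 1
    · simp [Matrix.one_apply]
    · simp_rw [Finset.sum_mul, Finset.mul_sum]
      rw [Finset.sum_comm]
      exact Finset.sum_congr rfl fun x _ => Finset.sum_congr rfl fun z _ => by ring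
  rw [MDP.stateOcc, h2, mul_add]
  simp only [MDP.stateOcc]
  congr 1
  rw [mul_left_comm]
  congr 1
  rw [Finset.mul_sum]
  exact Finset.sum_congr rfl fun x _ => (mul_assoc _ _ _).symm

lemma MDP.stateOcc_mem (M : MDP X A) (p : Policy X A) :
    M.stateOcc p ∈ stdSimplex ℝ (Fin X) := by
  refine ⟨fun x => mul_nonneg M.one_sub_γ_pos.le (Finset.sum_nonneg fun z _ =>
    mul_nonneg (M.α_mem.1 z) (tsum_nonneg fun t =>
      mul_nonneg (pow_nonneg M.γ_nonneg t) ((M.chain_pow_mem p t z).1 x))), ?_⟩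
  have h : ∑ y, M.stateOcc p y = (1 - M.γ) + M.γ * ∑ x, M.stateOcc p x := by
    conv_lhs => rw [Finset.sum_congr rfl fun y _ => M.stateOcc_eq p y]
    rw [Finset.sum_add_distrib,
      ← Finset.mul_sum, ← Finset.mul_sum, M.α_mem.2, mul_one, Finset.sum_comm]
    simp_rw [← Finset.mul_sum, Matrix.sum_row_of_mem_rowStochastic (M.chain_mem p), mul_one]
  have h' : (1 - M.γ) * (∑ y, M.stateOcc p y - 1) = 0 := by linear_combination h
  have := (mul_eq_zero.1 h').resolve_left M.one_sub_γ_pos.ne'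
  linarith

lemma MDP.occ_nonneg (M : MDP X A) (p : Policy X A) (x : Fin X) (a : Fin A) :
    0 ≤ M.occ p x a :=
  mul_nonneg ((M.stateOcc_mem p).1 x) ((p.prob_mem x).1 a)

lemma MDP.sum_occ_right (M : MDP X A) (p : Policy X A) (x : Fin X) :
    ∑ a, M.occ p x a = M.stateOcc p x := by
  simp only [MDP.occ]
  rw [← Finset.mul_sum, (p.prob_mem x).2, mul_one]

lemma MDP.sum_occ (M : MDP X A) (p : Policy X A) : ∑ x, ∑ a, M.occ p x a = 1 := by
  simp_rw [M.sum_occ_right]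
  exact (M.stateOcc_mem p).2

lemma MDP.occ_flow (M : MDP X A) (p : Policy X A) (y : Fin X) :
    ∑ a, M.occ p y a = (1 - M.γ) * M.α y + M.γ * ∑ x, ∑ a, M.occ p x a * M.P x a y := by
  rw [M.sum_occ_right, M.stateOcc_eq]
  congr 2
  refine Finset.sum_congr rfl fun x _ => ?_
  simp only [MDP.chain, MDP.occ, Matrix.of_apply, Finset.mul_sum, mul_assoc]

lemma MDP.J_eq_sum (M : MDP X A) (p : Policy X A) : M.J p = ∑ x, M.α x * M.value p x := rfl

/-- If `ζ` solves the flow equation of `π` up to an error `e`, then pairing with the Bellman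
equation gives `(1-γ) ζᵀ c_π = (1-γ) J(π) + eᵀ V_π`. -/
lemma MDP.flow_value (M : MDP X A) (p : Policy X A) (ζ e : Fin X → ℝ)
    (h : ∀ y, ζ y = (1 - M.γ) * M.α y + M.γ * ∑ x, ζ x * M.chain p x y + e y) :
    (1 - M.γ) * ∑ x, ζ x * M.chainCost p x =
      (1 - M.γ) * M.J p + ∑ x, e x * M.value p x := by
  have h1 : ∑ y, ζ y * M.value p y = (1 - M.γ) * M.J p +
      M.γ * (∑ y, (∑ x, ζ x * M.chain p x y) * M.value p y) + ∑ x, e x * M.value p x := by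
    rw [M.J_eq_sum, Finset.mul_sum, Finset.mul_sum, ← Finset.sum_add_distrib,
      ← Finset.sum_add_distrib]
    refine Finset.sum_congr rfl fun y _ => ?_
    conv_lhs => rw [h y]
    ring
  have h2 : ∑ y, ζ y * M.value p y = (1 - M.γ) * ∑ x, ζ x * M.chainCost p x +
      M.γ * ∑ x, ζ x * ∑ y, M.chain p x y * M.value p y := by
    rw [Finset.mul_sum, Finset.mul_sum, ← Finset.sum_add_distrib]
    refine Finset.sum_congr rfl fun x _ => ?_
    conv_lhs => rw [M.value_eq p x]
    ring
  have h3 : ∑ y, (∑ x, ζ x * M.chain p x y) * M.value p y =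
      ∑ x, ζ x * ∑ y, M.chain p x y * M.value p y := by
    simp_rw [Finset.sum_mul, Finset.mul_sum]
    rw [Finset.sum_comm]
    exact Finset.sum_congr rfl fun x _ => Finset.sum_congr rfl fun y _ => by ring
  rw [h3] at h1
  linarith

lemma sum_mul_chainCost (M : MDP X A) (p : Policy X A) (ζ : Fin X → ℝ) :
    ∑ x, ζ x * M.chainCost p x = ∑ x, ∑ a, (ζ x * p.prob x a) * M.c x a := by
  simp only [MDP.chainCost, Finset.mul_sum, mul_assoc]

lemma MDP.J_eq_sum_occ (M : MDP X A) (p : Policy X A) :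
    M.J p = ∑ x, ∑ a, M.occ p x a * M.c x a := by
  have h := M.flow_value p (M.stateOcc p) 0 fun y => by simpa using M.stateOcc_eq p y
  rw [sum_mul_chainCost] at h
  simp only [Pi.zero_apply, zero_mul, Finset.sum_const_zero, add_zero] at h
  exact (mul_left_cancel₀ M.one_sub_γ_pos.ne' h).symm

lemma MDP.abs_J_le (M : MDP X A) (p : Policy X A) : |M.J p| ≤ M.costBound :=
  abs_sum_mul_le M.α_mem (M.abs_value_le p)

/-! ### Optimal mixtures -/

lemma MDP.continuous_J_mixture (M : MDP X A) (π : Fin m → Policy X A) :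
    Continuous fun w : stdSimplex ℝ (Fin m) => M.J (mixture π w) := by
  have hprob : ∀ x a, Continuous fun w : stdSimplex ℝ (Fin m) => (mixture π w).prob x a := by
    intro x a
    simp only [mixture]
    exact continuous_finsetSum _ fun i _ =>
      ((continuous_apply i).comp continuous_subtype_val).mul continuous_const
  have hchain : Continuous fun w : stdSimplex ℝ (Fin m) => M.chain (mixture π w) := by
    refine continuous_matrix fun x y => ?_
    simp only [MDP.chain, Matrix.of_apply]
    exact continuous_finsetSum _ fun a _ => (hprob x a).mul continuous_const
  have hcost : Continuous fun w : stdSimplex ℝ (Fin m) => M.chainCost (mixture π w) := by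
    refine continuous_pi fun x => ?_
    simp only [MDP.chainCost]
    exact continuous_finsetSum _ fun a _ => (hprob x a).mul continuous_const
  simp only [MDP.J, MDP.value]
  refine continuous_finsetSum _ fun x _ => continuous_const.mul (continuous_const.mul ?_)
  refine continuous_tsum (fun t => ?_) (M.hasSum_discount.summable.mul_right M.costBound)
    fun t w => M.norm_value_term_le (mixture π w) x t
  exact continuous_const.mul ((continuous_apply x).comp ((hchain.pow t).matrix_mulVec hcost))

lemma exists_isOptimalMixture [NeZero m] (M : MDP X A) (π : Fin m → Policy X A) :
    ∃ w, IsOptimalMixture M π w := by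
  have : CompactSpace (stdSimplex ℝ (Fin m)) :=
    isCompact_iff_compactSpace.1 (isCompact_stdSimplex ℝ (Fin m))
  have : Nonempty (stdSimplex ℝ (Fin m)) := ⟨⟨_, single_mem_stdSimplex ℝ (0 : Fin m)⟩⟩
  obtain ⟨w, hw⟩ := (M.continuous_J_mixture π).exists_forall_le_of_hasCompactSupport
    (HasCompactSupport.of_compactSpace _)
  exact ⟨w, hw⟩

/-! ### The cost of the policy of a signed combination of occupancy measures -/

variable (M : MDP X A) (π : Fin m → Policy X A)

/-- `cᵀ ξ_θ`. -/
def MDP.dualCost (θ : EuclideanSpace ℝ (Fin m)) : ℝ := ∑ x, ∑ a, M.xi π θ x a * M.c x a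

lemma MDP.xi_add (θ θ' : EuclideanSpace ℝ (Fin m)) (x : Fin X) (a : Fin A) :
    M.xi π (θ + θ') x a = M.xi π θ x a + M.xi π θ' x a := by
  simp [MDP.xi, add_mul, Finset.sum_add_distrib]

lemma MDP.xi_smul (r : ℝ) (θ : EuclideanSpace ℝ (Fin m)) (x : Fin X) (a : Fin A) :
    M.xi π (r • θ) x a = r * M.xi π θ x a := by
  simp [MDP.xi, mul_assoc, Finset.mul_sum]

lemma MDP.dualCost_add (θ θ' : EuclideanSpace ℝ (Fin m)) :
    M.dualCost π (θ + θ') = M.dualCost π θ + M.dualCost π θ' := by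
  simp [MDP.dualCost, M.xi_add, add_mul, Finset.sum_add_distrib]

lemma MDP.dualCost_smul (r : ℝ) (θ : EuclideanSpace ℝ (Fin m)) :
    M.dualCost π (r • θ) = r * M.dualCost π θ := by
  simp [MDP.dualCost, M.xi_smul, mul_assoc, Finset.mul_sum]

lemma MDP.dualCost_eq (θ : EuclideanSpace ℝ (Fin m)) :
    M.dualCost π θ = ∑ i, θ i * M.J (π i) := by
  simp only [MDP.dualCost, MDP.xi, M.J_eq_sum_occ, Finset.mul_sum, Finset.sum_mul]
  have h1 : ∀ x, ∑ a, ∑ i, θ i * M.occ (π i) x a * M.c x a =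
      ∑ i, ∑ a, θ i * M.occ (π i) x a * M.c x a := fun x => Finset.sum_comm
  simp_rw [h1]
  rw [Finset.sum_comm]
  simp only [mul_assoc]

lemma MDP.J_add_dualGap (w : stdSimplex ℝ (Fin m)) {S : ℝ} {θ : EuclideanSpace ℝ (Fin m)}
    (hθ : θ ∈ Theta m S) : M.J (mixture π w) + M.dualGap π w θ = M.dualCost π θ := by
  have h : M.dualGap π w θ = ∑ i, θ i * (M.J (π i) - M.J (mixture π w)) := by
    simp only [MDP.dualGap, M.J_eq_sum_occ, sub_mul, Finset.sum_sub_distrib]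
  rw [h, M.dualCost_eq]
  simp_rw [mul_sub, Finset.sum_sub_distrib, ← Finset.sum_mul, hθ.1, one_mul]
  ring

lemma MDP.continuous_xi (x : Fin X) (a : Fin A) : Continuous fun θ => M.xi π θ x a := by
  simp only [MDP.xi]
  fun_prop

lemma MDP.continuous_dualCost : Continuous (M.dualCost π) := by
  have := M.continuous_xi π
  unfold MDP.dualCost
  exact continuous_finsetSum _ fun x _ => continuous_finsetSum _ fun a _ =>
    (this x a).mul continuous_const

lemma MDP.continuous_violation : Continuous (M.violation π) := by
  have := M.continuous_xi π
  unfold MDP.violation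
  exact continuous_finsetSum _ fun x _ => continuous_finsetSum _ fun a _ =>
    ((this x a).min continuous_const).abs

lemma MDP.violation_nonneg (θ : EuclideanSpace ℝ (Fin m)) : 0 ≤ M.violation π θ :=
  Finset.sum_nonneg fun _ _ => Finset.sum_nonneg fun _ _ => abs_nonneg _

lemma sum_abs_le {S : ℝ} {θ : EuclideanSpace ℝ (Fin m)} (hθ : ‖θ‖ ≤ S) :
    ∑ i, |θ i| ≤ S * m := by
  calc ∑ i, |θ i| ≤ ∑ _i : Fin m, S :=
        Finset.sum_le_sum fun i _ => (PiLp.norm_apply_le θ i).trans hθ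
    _ = S * m := by simp [mul_comm]

lemma MDP.abs_dualCost_le {S : ℝ} {θ : EuclideanSpace ℝ (Fin m)} (hθ : ‖θ‖ ≤ S) :
    |M.dualCost π θ| ≤ S * m * M.costBound := by
  rw [M.dualCost_eq]
  calc |∑ i, θ i * M.J (π i)| ≤ ∑ i, |θ i * M.J (π i)| := Finset.abs_sum_le_sum_abs _ _
    _ ≤ ∑ i, |θ i| * M.costBound := Finset.sum_le_sum fun i _ => by
        rw [abs_mul]
        exact mul_le_mul_of_nonneg_left (M.abs_J_le _) (abs_nonneg _)
    _ ≤ _ := by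
        rw [← Finset.sum_mul]
        exact mul_le_mul_of_nonneg_right (sum_abs_le hθ) M.costBound_nonneg

/-- Signed combinations of occupancy measures satisfy the flow equation, with the total weight as
an additional factor of the source term. -/
lemma MDP.xi_flow (θ : EuclideanSpace ℝ (Fin m)) (y : Fin X) :
    ∑ a, M.xi π θ y a =
      (1 - M.γ) * (∑ i, θ i) * M.α y + M.γ * ∑ x, ∑ a, M.xi π θ x a * M.P x a y := by
  have h1 : ∑ a, M.xi π θ y a = ∑ i, θ i * ∑ a, M.occ (π i) y a := by
    simp only [MDP.xi, Finset.mul_sum]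
    exact Finset.sum_comm
  have h2 : ∑ x, ∑ a, M.xi π θ x a * M.P x a y =
      ∑ i, θ i * ∑ x, ∑ a, M.occ (π i) x a * M.P x a y := by
    simp only [MDP.xi, Finset.mul_sum, Finset.sum_mul]
    have h : ∀ x, ∑ a, ∑ i, θ i * M.occ (π i) x a * M.P x a y =
        ∑ i, ∑ a, θ i * M.occ (π i) x a * M.P x a y := fun x => Finset.sum_comm
    simp_rw [h]
    rw [Finset.sum_comm]
    simp only [mul_assoc]
  rw [h1, h2]
  simp_rw [M.occ_flow, mul_add, Finset.sum_add_distrib, ← Finset.sum_mul]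
  congr 1
  · ring
  · rw [Finset.mul_sum]
    exact Finset.sum_congr rfl fun i _ => by ring

lemma sum_max_mul_normalizePos [NeZero A] (ξ : Fin X → Fin A → ℝ) (x : Fin X) (a : Fin A) :
    (∑ a', max (ξ x a') 0) * (normalizePos ξ).prob x a = max (ξ x a) 0 := by
  simp only [normalizePos]
  split_ifs with h
  · simp [fun a' => max_eq_right (h a')]
  · refine mul_div_cancel₀ _ (ne_of_gt ?_)
    push Not at h
    obtain ⟨a, ha⟩ := h
    exact Finset.sum_pos' (fun i _ => le_max_right _ _)
      ⟨a, Finset.mem_univ a, lt_max_of_lt_left ha⟩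

/-- If `∑ᵢ θᵢ = 1`, the cost of the policy `π_θ` differs from `cᵀ ξ_θ` by at most
`3 C U(θ) / (1-γ)`: the positive part of `ξ_θ` is the product of its state marginal with `π_θ`, and
it satisfies the flow equation of `π_θ` up to an error of `ℓ¹`-norm at most `2 U(θ)`. A total weight
different from one, as that of an average of iterates which includes the starting point `0`,
contributes an additional error. -/
lemma MDP.abs_J_dualPolicy_sub_le [NeZero A] (θ : EuclideanSpace ℝ (Fin m)) :
    |M.J (M.dualPolicy π θ) - M.dualCost π θ| ≤
      M.costBound * (3 * (M.violation π θ / (1 - M.γ)) + |∑ i, θ i - 1|) := by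
  set p := M.dualPolicy π θ with hp
  set ξ := M.xi π θ with hξ
  set U := M.violation π θ with hU
  have hγ := M.one_sub_γ_pos
  have hγ0 := M.γ_nonneg
  have hC := M.costBound_nonneg
  have hU0 : 0 ≤ U := M.violation_nonneg π θ
  have hpos : ∀ x a, max (ξ x a) 0 = ξ x a + |min (ξ x a) 0| := fun x a => by
    rw [abs_of_nonpos (min_le_right _ _)]
    linarith [max_add_min (ξ x a) 0]
  set ζ : Fin X → ℝ := fun x => ∑ a, max (ξ x a) 0 with hζ
  have hζp : ∀ x a, ζ x * p.prob x a = max (ξ x a) 0 := sum_max_mul_normalizePos ξ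
  set e : Fin X → ℝ := fun y => ∑ a, |min (ξ y a) 0| -
    M.γ * ∑ x, ∑ a, |min (ξ x a) 0| * M.P x a y + (1 - M.γ) * (∑ i, θ i - 1) * M.α y with he
  have hflow : ∀ y, ζ y = (1 - M.γ) * M.α y + M.γ * ∑ x, ζ x * M.chain p x y + e y := by
    intro y
    have h1 : ∑ x, ζ x * M.chain p x y = ∑ x, ∑ a, max (ξ x a) 0 * M.P x a y := by
      simp only [MDP.chain, Matrix.of_apply, Finset.mul_sum, ← mul_assoc, hζp]
    rw [h1]
    simp only [hζ, he, hpos, add_mul, Finset.sum_add_distrib]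
    rw [M.xi_flow π θ y]
    ring
  have hval := M.flow_value p ζ e hflow
  rw [sum_mul_chainCost] at hval
  simp only [hζp] at hval
  have he1 : ∑ y, |e y| ≤ 2 * U + (1 - M.γ) * |∑ i, θ i - 1| := by
    calc ∑ y, |e y| ≤ ∑ y, (∑ a, |min (ξ y a) 0| + ∑ x, ∑ a, |min (ξ x a) 0| * M.P x a y +
            (1 - M.γ) * |∑ i, θ i - 1| * M.α y) := by
          refine Finset.sum_le_sum fun y _ => ?_
          have h0 : 0 ≤ ∑ a, |min (ξ y a) 0| := Finset.sum_nonneg fun _ _ => abs_nonneg _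
          have h1 : 0 ≤ ∑ x, ∑ a, |min (ξ x a) 0| * M.P x a y :=
            Finset.sum_nonneg fun x _ => Finset.sum_nonneg fun a _ =>
              mul_nonneg (abs_nonneg _) ((M.P_mem x a).1 y)
          have h2 := mul_le_of_le_one_left h1 M.γ_mem.2.le
          have h3 := mul_nonneg hγ0 h1
          have h4 : |(1 - M.γ) * (∑ i, θ i - 1) * M.α y| =
              (1 - M.γ) * |∑ i, θ i - 1| * M.α y := by
            rw [abs_mul, abs_mul, abs_of_pos hγ, abs_of_nonneg (M.α_mem.1 y)]
          simp only [he]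
          rw [← h4]
          refine (abs_add_le _ _).trans (add_le_add_left (abs_le.2 ⟨?_, ?_⟩) _) <;> linarith
      _ = _ := by
          have h3 : ∑ y, ∑ x, ∑ a, |min (ξ x a) 0| * M.P x a y = U := by
            rw [Finset.sum_comm]
            refine Finset.sum_congr rfl fun x _ => ?_
            rw [Finset.sum_comm]
            refine Finset.sum_congr rfl fun a _ => ?_
            rw [← Finset.mul_sum, (M.P_mem x a).2, mul_one]
          rw [Finset.sum_add_distrib, Finset.sum_add_distrib, h3, ← Finset.mul_sum, M.α_mem.2,
            mul_one, two_mul]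
          rfl
  have he2 : |∑ x, e x * M.value p x| ≤ (2 * U + (1 - M.γ) * |∑ i, θ i - 1|) * M.costBound := by
    calc |∑ x, e x * M.value p x| ≤ ∑ x, |e x * M.value p x| := Finset.abs_sum_le_sum_abs _ _
      _ ≤ ∑ x, |e x| * M.costBound := Finset.sum_le_sum fun x _ => by
          rw [abs_mul]
          exact mul_le_mul_of_nonneg_left (M.abs_value_le p x) (abs_nonneg _)
      _ ≤ _ := by
          rw [← Finset.sum_mul]
          exact mul_le_mul_of_nonneg_right he1 hC
  set N := ∑ x, ∑ a, |min (ξ x a) 0| * M.c x a with hN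
  have hN1 : |N| ≤ U * M.costBound := by
    rw [hU, MDP.violation, Finset.sum_mul]
    refine (Finset.abs_sum_le_sum_abs _ _).trans (Finset.sum_le_sum fun x _ => ?_)
    rw [Finset.sum_mul]
    refine (Finset.abs_sum_le_sum_abs _ _).trans (Finset.sum_le_sum fun a _ => ?_)
    rw [abs_mul, abs_abs]
    exact mul_le_mul_of_nonneg_left (M.abs_c_le x a) (abs_nonneg _)
  have hsplit : ∑ x, ∑ a, max (ξ x a) 0 * M.c x a = M.dualCost π θ + N := by
    simp only [hpos, add_mul, Finset.sum_add_distrib, hN]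
    rfl
  rw [hsplit] at hval
  have hdiff : (1 - M.γ) * (M.J p - M.dualCost π θ) =
      (1 - M.γ) * N - ∑ x, e x * M.value p x := by linarith
  have key : (1 - M.γ) * |M.J p - M.dualCost π θ| ≤
      (1 - M.γ) * (M.costBound * (3 * (U / (1 - M.γ)) + |∑ i, θ i - 1|)) := by
    have h5 : (1 - M.γ) * (M.costBound * (3 * (U / (1 - M.γ)) + |∑ i, θ i - 1|)) =
        M.costBound * (3 * U + (1 - M.γ) * |∑ i, θ i - 1|) := by
      field_simp
    rw [h5, ← abs_of_pos hγ, ← abs_mul, hdiff, abs_of_pos hγ]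
    have h4 : |(1 - M.γ) * N| ≤ U * M.costBound := by
      rw [abs_mul, abs_of_pos hγ]
      exact (mul_le_of_le_one_left (abs_nonneg _) (by linarith)).trans hN1
    calc _ ≤ |(1 - M.γ) * N| + |∑ x, e x * M.value p x| := abs_sub _ _
      _ ≤ _ := by linarith
  exact le_of_mul_le_mul_left key hγ

/-! ### The Euclidean projection onto the dual parameters -/

lemma isCompact_Theta (m : ℕ) (S : ℝ) : IsCompact (Theta m S) := by
  have h : Theta m S = {θ | ∑ i, θ i = 1} ∩ Metric.closedBall 0 S := by
    ext θ
    simp [Theta]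
  rw [h]
  exact (isCompact_closedBall _ _).inter_left (isClosed_eq (by fun_prop) continuous_const)

/-- Any radius for which `Θ` is non-empty satisfies `1/m ≤ S²`, by the Cauchy-Schwarz
inequality. -/
lemma inv_le_sq_of_Theta_nonempty [NeZero m] {S : ℝ} (h : (Theta m S).Nonempty) :
    1 / (m : ℝ) ≤ S ^ 2 := by
  obtain ⟨θ, h1, h2⟩ := h
  have hm : (0 : ℝ) < m := Nat.cast_pos.2 (NeZero.pos m)
  have h3 : (∑ i, θ i) ^ 2 ≤ m * ∑ i, θ i ^ 2 := by
    simpa using sq_sum_le_card_mul_sum_sq (s := Finset.univ) (f := fun i => θ i)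
  rw [h1, ← EuclideanSpace.real_norm_sq_eq] at h3
  have h4 : ‖θ‖ ^ 2 ≤ S ^ 2 := pow_le_pow_left₀ (norm_nonneg _) h2 2
  rw [div_le_iff₀ hm]
  nlinarith

lemma radius_pos_of_Theta_nonempty {S : ℝ} (h : (Theta m S).Nonempty) : 0 < S := by
  obtain ⟨θ, h1, h2⟩ := h
  refine lt_of_lt_of_le (norm_pos_iff.2 ?_) h2
  rintro rfl
  simp at h1

/-- The point computed by projecting `y` onto the hyperplane `∑ᵢ θᵢ = 1` and shrinking it towards
the centre `(1/m, …, 1/m)` of that hyperplane if necessary. -/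
def shrinkProj (S : ℝ) (y : Fin m → ℝ) : Fin m → ℝ :=
  let z : Fin m → ℝ := fun i => y i + (1 - ∑ i, y i) / m
  let d : Fin m → ℝ := fun i => z i - 1 / m
  let n2 := ∑ i, d i * d i
  let r2 := S * S - 1 / m
  if r2 < n2 then fun i => 1 / m + Real.sqrt (r2 / n2) * d i else z

/-- The shrunken point lies in `Θ` and satisfies the variational inequality of the projection. -/
lemma shrinkProj_spec [NeZero m] {S : ℝ} (h : (Theta m S).Nonempty)
    (y : EuclideanSpace ℝ (Fin m)) :
    WithLp.toLp 2 (shrinkProj S y) ∈ Theta m S ∧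
      ∀ q ∈ Theta m S, ∑ i, (y i - shrinkProj S y i) * (q i - shrinkProj S y i) ≤ 0 := by
  have hm : (0 : ℝ) < m := Nat.cast_pos.2 (NeZero.pos m)
  have hS := radius_pos_of_Theta_nonempty h
  have hr := inv_le_sq_of_Theta_nonempty h
  set c : ℝ := 1 / m with hc
  have hmc : m * c = 1 := by rw [hc]; field_simp
  set k : ℝ := (1 - ∑ i, y i) / m with hk
  have hmk : m * k = 1 - ∑ i, y i := by rw [hk]; field_simp
  set d : Fin m → ℝ := fun i => y i + k - c with hd
  have hd0 : ∑ i, d i = 0 := by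
    simp only [hd, Finset.sum_sub_distrib, Finset.sum_add_distrib, Finset.sum_const,
      Finset.card_univ, Fintype.card_fin, nsmul_eq_mul, hmc, hmk]
    ring
  set n2 : ℝ := ∑ i, d i * d i with hn2
  set r2 : ℝ := S * S - c with hr2
  have hr20 : 0 ≤ r2 := by rw [hr2]; nlinarith
  have hn20 : 0 ≤ n2 := Finset.sum_nonneg fun i _ => mul_self_nonneg _
  -- membership of a point `c + f d`, and the inner product with the direction to another point
  have hmem : ∀ f : ℝ, f ^ 2 * n2 ≤ r2 → WithLp.toLp 2 (fun i => c + f * d i) ∈ Theta m S := by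
    intro f hf
    refine ⟨?_, ?_⟩
    · simp only [Finset.sum_add_distrib, ← Finset.mul_sum, hd0, Finset.sum_const,
        Finset.card_univ, Fintype.card_fin, nsmul_eq_mul, hmc]
      ring
    · refine abs_le_of_sq_le_sq' ?_ hS.le |>.2
      rw [EuclideanSpace.real_norm_sq_eq]
      have : ∀ i, (c + f * d i) ^ 2 = c * c + 2 * c * f * d i + f ^ 2 * (d i * d i) :=
        fun i => by ring
      simp only [this, Finset.sum_add_distrib, ← Finset.mul_sum, hd0, Finset.sum_const,
        Finset.card_univ, Fintype.card_fin, nsmul_eq_mul, ← hn2, hmc]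
      nlinarith
  have hvar : ∀ f : ℝ, ∀ q ∈ Theta m S, ∑ i, (y i - (c + f * d i)) * (q i - (c + f * d i)) =
      (1 - f) * (∑ i, d i * (q i - c) - f * n2) := by
    intro f q hq
    have hterm : ∀ i, (y i - (c + f * d i)) * (q i - (c + f * d i)) =
        (1 - f) * (d i * (q i - c)) - (1 - f) * f * (d i * d i) -
          k * (q i - c) + k * f * d i := fun i => by simp only [hd]; ring
    have hq0 : ∑ i, (q i - c) = 0 := by
      simp [Finset.sum_sub_distrib, hq.1, hmc]
    simp only [hterm, Finset.sum_add_distrib, Finset.sum_sub_distrib, ← Finset.mul_sum] at hq0 ⊢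
    rw [hd0, hq0, ← hn2]
    ring
  have hproj : shrinkProj S y =
      if r2 < n2 then fun i => c + Real.sqrt (r2 / n2) * d i else fun i => c + 1 * d i := by
    simp only [shrinkProj]
    split_ifs
    · rfl
    · funext i
      simp only [hd]
      ring
  rw [hproj]
  split_ifs with hlt
  · have hn2pos : 0 < n2 := hr20.trans_lt hlt
    have hf2 : Real.sqrt (r2 / n2) ^ 2 = r2 / n2 := Real.sq_sqrt (div_nonneg hr20 hn20)
    have hf1 : Real.sqrt (r2 / n2) ≤ 1 := Real.sqrt_le_one.2 ((div_le_one hn2pos).2 hlt.le)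
    refine ⟨hmem _ (by rw [hf2, div_mul_cancel₀ _ hn2pos.ne']), fun q hq => ?_⟩
    rw [hvar _ q hq]
    refine mul_nonpos_of_nonneg_of_nonpos (by linarith) (sub_nonpos.2 ?_)
    have hq2 : ∑ i, (q i - c) ^ 2 ≤ r2 := by
      have h1 : ∑ i, q i ^ 2 ≤ S ^ 2 := by
        rw [← EuclideanSpace.real_norm_sq_eq]
        exact pow_le_pow_left₀ (norm_nonneg _) hq.2 2
      have h2 : ∀ i, (q i - c) ^ 2 = q i ^ 2 - 2 * c * q i + c * c := fun i => by ring
      simp only [h2, Finset.sum_add_distrib, Finset.sum_sub_distrib, ← Finset.mul_sum, hq.1,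
        Finset.sum_const, Finset.card_univ, Fintype.card_fin, nsmul_eq_mul, hmc]
      nlinarith
    have hcs := Finset.sum_mul_sq_le_sq_mul_sq Finset.univ d (fun i => q i - c)
    have hd2 : ∑ i, d i ^ 2 = n2 := by simp only [hn2, sq]
    rw [hd2] at hcs
    refine abs_le_of_sq_le_sq' ?_ (by positivity) |>.2
    calc _ ≤ n2 * r2 := hcs.trans (mul_le_mul_of_nonneg_left hq2 hn20)
      _ = _ := by
        rw [mul_pow, hf2]
        field_simp
  · refine ⟨hmem 1 (by linarith), fun q hq => ?_⟩
    rw [hvar 1 q hq]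
    simp

lemma shrinkProj_dist_sq [NeZero m] {S : ℝ} (h : (Theta m S).Nonempty)
    (y : EuclideanSpace ℝ (Fin m)) {q : EuclideanSpace ℝ (Fin m)} (hq : q ∈ Theta m S) :
    dist y (WithLp.toLp 2 (shrinkProj S y)) ^ 2 + dist (WithLp.toLp 2 (shrinkProj S y)) q ^ 2 ≤
      dist y q ^ 2 := by
  have hv := (shrinkProj_spec h y).2 q hq
  simp only [EuclideanSpace.dist_eq, Real.dist_eq, sq_abs]
  rw [Real.sq_sqrt (Finset.sum_nonneg fun _ _ => sq_nonneg _),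
    Real.sq_sqrt (Finset.sum_nonneg fun _ _ => sq_nonneg _),
    Real.sq_sqrt (Finset.sum_nonneg fun _ _ => sq_nonneg _), ← Finset.sum_add_distrib]
  have hterm : ∀ i, (y i - q i) ^ 2 = ((y i - shrinkProj S y i) ^ 2 +
      (shrinkProj S y i - q i) ^ 2) - 2 * ((y i - shrinkProj S y i) * (q i - shrinkProj S y i)) :=
    fun i => by ring
  simp only [hterm]
  rw [Finset.sum_sub_distrib, ← Finset.mul_sum]
  linarith

lemma projTheta_eq [NeZero m] {S : ℝ} (h : (Theta m S).Nonempty)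
    (y : EuclideanSpace ℝ (Fin m)) : projTheta S y = WithLp.toLp 2 (shrinkProj S y) := by
  have hp := (shrinkProj_spec h y).1
  set p : EuclideanSpace ℝ (Fin m) := WithLp.toLp 2 (shrinkProj S y) with hpdef
  have hex : ∃ p : EuclideanSpace ℝ (Fin m), p ∈ Theta m S ∧ ∀ q ∈ Theta m S, dist y p ≤ dist y q :=
    ⟨p, hp, fun q hq => abs_le_of_sq_le_sq' (by
      nlinarith [shrinkProj_dist_sq h y hq, sq_nonneg (dist p q)]) dist_nonneg |>.2⟩
  obtain ⟨h1, h2⟩ := Classical.epsilon_spec hex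
  have h3 := shrinkProj_dist_sq h y h1
  have h4 := pow_le_pow_left₀ dist_nonneg (h2 p hp) 2
  have h5 : dist p (projTheta S y) ^ 2 ≤ 0 := by
    rw [projTheta]
    linarith
  have h6 : dist p (projTheta S y) = 0 := by
    have := sq_nonneg (dist p (projTheta S y))
    exact pow_eq_zero_iff (n := 2) two_ne_zero |>.1 (le_antisymm h5 this)
  exact (dist_eq_zero.1 h6).symm

lemma projTheta_mem [NeZero m] {S : ℝ} (h : (Theta m S).Nonempty)
    (y : EuclideanSpace ℝ (Fin m)) : projTheta S y ∈ Theta m S := by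
  rw [projTheta_eq h]
  exact (shrinkProj_spec h y).1

lemma norm_projTheta_sub_sq_le [NeZero m] {S : ℝ} (y : EuclideanSpace ℝ (Fin m))
    {q : EuclideanSpace ℝ (Fin m)} (hq : q ∈ Theta m S) :
    ‖projTheta S y - q‖ ^ 2 ≤ ‖y - q‖ ^ 2 := by
  rw [projTheta_eq ⟨q, hq⟩, ← dist_eq_norm, ← dist_eq_norm]
  nlinarith [shrinkProj_dist_sq ⟨q, hq⟩ y hq, sq_nonneg (dist y (WithLp.toLp 2 (shrinkProj S y)))]

/-! ### Expectations under probability mass functions -/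

/-- The expectation of a function with values in `[0, ∞]`. -/
def lexp {β : Type} (p : PMF β) (F : β → ENNReal) : ENNReal := ∑' b, p b * F b

lemma lexp_pure {β : Type} (b : β) (F : β → ENNReal) : lexp (PMF.pure b) F = F b := by
  rw [lexp, tsum_eq_single b fun b' hb' => by simp [PMF.pure_apply_of_ne _ _ hb']]
  simp

lemma lexp_bind {β β' : Type} (p : PMF β) (f : β → PMF β') (F : β' → ENNReal) :
    lexp (p.bind f) F = lexp p fun b => lexp (f b) F := by
  simp only [lexp, PMF.bind_apply, ← ENNReal.tsum_mul_right, ← ENNReal.tsum_mul_left]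
  rw [ENNReal.tsum_comm]
  simp only [mul_assoc]

lemma lexp_map {β β' : Type} (p : PMF β) (f : β → β') (F : β' → ENNReal) :
    lexp (p.map f) F = lexp p (F ∘ f) := by
  rw [PMF.map, lexp_bind]
  simp [lexp_pure, Function.comp_def]

lemma lexp_mono {β : Type} (p : PMF β) {F G : β → ENNReal} (h : ∀ b ∈ p.support, F b ≤ G b) :
    lexp p F ≤ lexp p G := by
  refine ENNReal.tsum_le_tsum fun b => ?_
  by_cases hb : p b = 0
  · simp [hb]
  · gcongr
    exact h b ((PMF.mem_support_iff p b).2 hb)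

lemma lexp_mul_const {β : Type} (p : PMF β) (F : β → ENNReal) (r : ENNReal) :
    lexp p (fun b => F b * r) = lexp p F * r := by
  simp only [lexp, ← mul_assoc, ENNReal.tsum_mul_right]

lemma toOuterMeasure_le_lexp {β : Type} (p : PMF β) {s : Set β} {F : β → ENNReal}
    (h : ∀ b ∈ s, 1 ≤ F b) : p.toOuterMeasure s ≤ lexp p F := by
  rw [PMF.toOuterMeasure_apply]
  refine ENNReal.tsum_le_tsum fun b => ?_
  by_cases hb : b ∈ s
  · rw [Set.indicator_of_mem hb]
    exact le_mul_of_one_le_right' (h b hb)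
  · simp [hb]

lemma ofReal_one_sub_le_of_compl {β : Type} (p : PMF β) {s : Set β} {δ : ℝ} (hδ : 0 ≤ δ)
    (h : p.toOuterMeasure sᶜ ≤ ENNReal.ofReal δ) :
    ENNReal.ofReal (1 - δ) ≤ p.toOuterMeasure s := by
  have h1 : p.toOuterMeasure Set.univ = 1 := by
    rw [PMF.toOuterMeasure_apply, Set.indicator_univ]
    exact p.tsum_coe
  rw [ENNReal.ofReal_sub _ hδ, ENNReal.ofReal_one, tsub_le_iff_right, ← h1,
    ← Set.union_compl_self s]
  exact (MeasureTheory.measure_union_le s sᶜ).trans (by gcongr)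

/-- Hoeffding's lemma for a finitely supported law. -/
lemma sum_mul_exp_le {ι : Type*} [Fintype ι] {w D : ι → ℝ} {B : ℝ} (hw : w ∈ stdSimplex ℝ ι)
    (h0 : ∑ i, w i * D i = 0) (hD : ∀ i, |D i| ≤ B) (hB : 0 < B) :
    ∑ i, w i * Real.exp (D i) ≤ Real.exp (B ^ 2 / 2) := by
  have h1 : ∀ i, Real.exp (D i) ≤ Real.cosh B + D i / B * Real.sinh B := fun i => by
    have ht : |D i / B| ≤ 1 := by
      rw [abs_div, abs_of_pos hB]
      exact (div_le_one hB).2 (hD i)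
    simpa [div_mul_cancel₀ _ hB.ne'] using Real.exp_mul_le_cosh_add_mul_sinh ht B
  calc ∑ i, w i * Real.exp (D i)
      ≤ ∑ i, w i * (Real.cosh B + D i / B * Real.sinh B) :=
        Finset.sum_le_sum fun i _ => mul_le_mul_of_nonneg_left (h1 i) (hw.1 i)
    _ = Real.cosh B * ∑ i, w i + Real.sinh B / B * ∑ i, w i * D i := by
        rw [Finset.mul_sum, Finset.mul_sum, ← Finset.sum_add_distrib]
        exact Finset.sum_congr rfl fun i _ => by ring
    _ = Real.cosh B := by rw [hw.2, h0]; ring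
    _ ≤ _ := Real.cosh_le_exp_half_sq B

/-! ### The subgradient estimates -/

lemma discreteLaw_apply {ι : Type} [Fintype ι] [Nonempty ι] {p : ι → ℝ}
    (hp : p ∈ stdSimplex ℝ ι) (i : ι) : discreteLaw p i = ENNReal.ofReal (p i) := by
  have h : ∑ i, ENNReal.ofReal (p i) = 1 := by
    rw [← ENNReal.ofReal_sum_of_nonneg fun i _ => hp.1 i, hp.2, ENNReal.ofReal_one]
  rw [discreteLaw, dif_pos h, PMF.ofFintype_apply]

lemma MDP.occ_mem (M : MDP X A) (p : Policy X A) :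
    (fun xa : Fin X × Fin A => M.occ p xa.1 xa.2) ∈ stdSimplex ℝ (Fin X × Fin A) :=
  ⟨fun xa => M.occ_nonneg p xa.1 xa.2, by rw [Fintype.sum_prod_type]; exact M.sum_occ p⟩

section Subgradient

variable (M : MDP X A) (π : Fin m → Policy X A)

/-- The average `(1/m) ∑ᵢ μ_{πᵢ}` of the occupancy measures of the base policies. -/
def MDP.avgOcc (xa : Fin X × Fin A) : ℝ := 1 / m * ∑ i, M.occ (π i) xa.1 xa.2

lemma MDP.avgOcc_mem [NeZero m] : M.avgOcc π ∈ stdSimplex ℝ (Fin X × Fin A) := by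
  have hm : (m : ℝ) ≠ 0 := Nat.cast_ne_zero.2 (NeZero.ne m)
  refine ⟨fun xa => mul_nonneg (by positivity)
    (Finset.sum_nonneg fun i _ => M.occ_nonneg (π i) xa.1 xa.2), ?_⟩
  simp only [MDP.avgOcc]
  rw [← Finset.mul_sum, Finset.sum_comm]
  simp [(M.occ_mem _).2, hm]

lemma MDP.sampleLaw_apply [NeZero X] [NeZero A] [NeZero m] (xa : Fin X × Fin A) :
    M.sampleLaw π xa = ENNReal.ofReal (M.avgOcc π xa) := by
  have hm : (0 : ℝ) < m := Nat.cast_pos.2 (NeZero.pos m)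
  rw [MDP.sampleLaw, PMF.bind_apply, tsum_fintype, MDP.avgOcc,
    ENNReal.ofReal_mul (by positivity), ENNReal.ofReal_sum_of_nonneg
      fun i _ => M.occ_nonneg (π i) xa.1 xa.2, Finset.mul_sum]
  refine Finset.sum_congr rfl fun i _ => ?_
  rw [discreteLaw_apply (M.occ_mem (π i)), PMF.uniformOfFintype_apply, Fintype.card_fin,
    one_div, ENNReal.ofReal_inv_of_pos hm, ENNReal.ofReal_natCast]

lemma MDP.lexp_sampleLaw [NeZero X] [NeZero A] [NeZero m] {F : Fin X × Fin A → ℝ}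
    (hF : ∀ xa, 0 ≤ F xa) :
    lexp (M.sampleLaw π) (fun xa => ENNReal.ofReal (F xa)) =
      ENNReal.ofReal (∑ xa, M.avgOcc π xa * F xa) := by
  rw [lexp, tsum_fintype, ENNReal.ofReal_sum_of_nonneg
    fun xa _ => mul_nonneg ((M.avgOcc_mem π).1 xa) (hF xa)]
  refine Finset.sum_congr rfl fun xa _ => ?_
  rw [M.sampleLaw_apply, ENNReal.ofReal_mul ((M.avgOcc_mem π).1 xa)]

/-- The penalized cost `L(θ) = cᵀ ξ_θ + H U(θ)`. -/
def MDP.penalized (H : ℝ) (θ : EuclideanSpace ℝ (Fin m)) : ℝ :=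
  M.dualCost π θ + H * M.violation π θ

lemma MDP.violation_smul {r : ℝ} (hr : 0 ≤ r) (θ : EuclideanSpace ℝ (Fin m)) :
    M.violation π (r • θ) = r * M.violation π θ := by
  have h : ∀ v : ℝ, |min (r * v) 0| = r * |min v 0| := fun v => by
    rw [← abs_of_nonneg hr, ← abs_mul, abs_of_nonneg hr, mul_min_of_nonneg _ _ hr, mul_zero]
  simp only [MDP.violation, M.xi_smul, h, Finset.mul_sum]

lemma MDP.violation_add_le (θ θ' : EuclideanSpace ℝ (Fin m)) :
    M.violation π (θ + θ') ≤ M.violation π θ + M.violation π θ' := by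
  have h : ∀ v w : ℝ, |min (v + w) 0| ≤ |min v 0| + |min w 0| := fun v w => by
    rw [abs_of_nonpos (min_le_right _ _), abs_of_nonpos (min_le_right _ _),
      abs_of_nonpos (min_le_right _ _)]
    have : min v 0 + min w 0 ≤ min (v + w) 0 :=
      le_min (add_le_add (min_le_left _ _) (min_le_left _ _))
        (add_nonpos (min_le_right _ _) (min_le_right _ _))
    linarith
  simp only [MDP.violation, M.xi_add, ← Finset.sum_add_distrib]
  exact Finset.sum_le_sum fun x _ => Finset.sum_le_sum fun a _ => h _ _

lemma MDP.penalized_smul (H : ℝ) {r : ℝ} (hr : 0 ≤ r) (θ : EuclideanSpace ℝ (Fin m)) :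
    M.penalized π H (r • θ) = r * M.penalized π H θ := by
  rw [MDP.penalized, MDP.penalized, M.dualCost_smul, M.violation_smul π hr]
  ring

lemma MDP.penalized_add_le {H : ℝ} (hH : 0 ≤ H) (θ θ' : EuclideanSpace ℝ (Fin m)) :
    M.penalized π H (θ + θ') ≤ M.penalized π H θ + M.penalized π H θ' := by
  simp only [MDP.penalized, M.dualCost_add]
  have := mul_le_mul_of_nonneg_left (M.violation_add_le π θ θ') hH
  linarith

lemma MDP.penalized_zero (H : ℝ) : M.penalized π H 0 = 0 := by
  simpa using M.penalized_smul π H le_rfl 0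

lemma MDP.inner_subgrad (H : ℝ) (θ v : EuclideanSpace ℝ (Fin m)) (xa : Fin X × Fin A) :
    inner ℝ (M.subgrad π H θ xa) v = M.dualCost π v -
      H * (m * M.xi π v xa.1 xa.2 / ∑ i, M.occ (π i) xa.1 xa.2) *
        (if M.xi π θ xa.1 xa.2 < 0 then 1 else 0) := by
  simp only [PiLp.inner_apply, MDP.subgrad, RCLike.inner_apply, conj_trivial, mul_sub,
    Finset.sum_sub_distrib]
  congr 1
  · rw [M.dualCost_eq]
    simp only [M.J_eq_sum_occ, mul_comm (M.c _ _)]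
  · simp only [MDP.xi, Finset.mul_sum, Finset.sum_mul, Finset.sum_div]
    exact Finset.sum_congr rfl fun i _ => by ring

/-- The estimate `g(θ)` is unbiased for a subgradient of the penalized cost. -/
lemma MDP.penalized_sub_le [NeZero m] {H : ℝ} (hH : 0 ≤ H) (θ q : EuclideanSpace ℝ (Fin m)) :
    M.penalized π H θ - M.penalized π H q ≤
      ∑ xa, M.avgOcc π xa * inner ℝ (M.subgrad π H θ xa) (θ - q) := by
  have hm : (m : ℝ) ≠ 0 := Nat.cast_ne_zero.2 (NeZero.ne m)
  set v := θ - q with hv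
  have hθ : θ = v + q := by rw [hv, sub_add_cancel]
  have h1 : ∀ xa, M.avgOcc π xa * inner ℝ (M.subgrad π H θ xa) v =
      M.avgOcc π xa * M.dualCost π v -
        H * (if M.xi π θ xa.1 xa.2 < 0 then M.xi π v xa.1 xa.2 else 0) := by
    intro xa
    rw [M.inner_subgrad, mul_sub]
    congr 1
    by_cases h : M.xi π θ xa.1 xa.2 < 0
    · simp only [h, if_true, MDP.avgOcc]
      by_cases h0 : ∑ i, M.occ (π i) xa.1 xa.2 = 0
      · -- a pair visited by no base policy contributes nothing to `ξ_v`
        have h2 : M.xi π v xa.1 xa.2 = 0 := by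
          rw [Finset.sum_eq_zero_iff_of_nonneg fun i _ => M.occ_nonneg (π i) xa.1 xa.2] at h0
          exact Finset.sum_eq_zero fun i hi => by rw [h0 i hi, mul_zero]
        simp [h0, h2]
      · field_simp
    · simp [h]
  simp only [h1, Finset.sum_sub_distrib, ← Finset.sum_mul, (M.avgOcc_mem π).2, one_mul,
    ← Finset.mul_sum]
  have h3 : M.dualCost π θ = M.dualCost π v + M.dualCost π q := by
    rw [← M.dualCost_add, ← hθ]
  have h4 : M.violation π θ + ∑ xa : Fin X × Fin A,
      (if M.xi π θ xa.1 xa.2 < 0 then M.xi π v xa.1 xa.2 else 0) ≤ M.violation π q := by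
    simp only [MDP.violation, ← Fintype.sum_prod_type']
    rw [← Finset.sum_add_distrib]
    refine Finset.sum_le_sum fun xa _ => ?_
    have h5 : M.xi π θ xa.1 xa.2 = M.xi π v xa.1 xa.2 + M.xi π q xa.1 xa.2 := by
      rw [← M.xi_add, ← hθ]
    split_ifs with h
    · rw [min_eq_left h.le, abs_of_neg h, abs_of_nonpos (min_le_right _ _)]
      linarith [min_le_left (M.xi π q xa.1 xa.2) 0]
    · rw [min_eq_right (not_lt.1 h)]
      simp
  have h6 := mul_le_mul_of_nonneg_left h4 hH
  simp only [MDP.penalized]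
  linarith

lemma norm_le_of_sum_sq_le {v : EuclideanSpace ℝ (Fin m)} {r : ℝ} (hr : 0 ≤ r)
    (h : ∑ i, v i ^ 2 ≤ r ^ 2) : ‖v‖ ≤ r := by
  rw [← EuclideanSpace.real_norm_sq_eq] at h
  exact abs_le_of_sq_le_sq' h hr |>.2

lemma MDP.norm_subgrad_le {H : ℝ} (hH : 0 ≤ H) (θ : EuclideanSpace ℝ (Fin m))
    (xa : Fin X × Fin A) :
    ‖M.subgrad π H θ xa‖ ≤ (1 + M.costBound) * (Real.sqrt m + H * m) := by
  set tot := ∑ i, M.occ (π i) xa.1 xa.2 with htot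
  have hC := M.costBound_nonneg
  have hocc : ∀ i, 0 ≤ M.occ (π i) xa.1 xa.2 := fun i => M.occ_nonneg (π i) xa.1 xa.2
  have htot0 : 0 ≤ tot := Finset.sum_nonneg fun i _ => hocc i
  set a : EuclideanSpace ℝ (Fin m) := WithLp.toLp 2 fun j => M.J (π j) with ha
  set b : EuclideanSpace ℝ (Fin m) := WithLp.toLp 2 fun j =>
    H * (m * M.occ (π j) xa.1 xa.2 / tot) * (if M.xi π θ xa.1 xa.2 < 0 then 1 else 0) with hb
  have hg : M.subgrad π H θ xa = a - b := by
    ext j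
    simp only [MDP.subgrad, ha, hb, PiLp.sub_apply, M.J_eq_sum_occ, mul_comm (M.c _ _)]
    rfl
  have ha1 : ‖a‖ ≤ M.costBound * Real.sqrt m := by
    refine norm_le_of_sum_sq_le (by positivity) ?_
    rw [mul_pow, Real.sq_sqrt (Nat.cast_nonneg m)]
    calc ∑ i, a i ^ 2 ≤ ∑ _i : Fin m, M.costBound ^ 2 := Finset.sum_le_sum fun i _ =>
          sq_le_sq.2 (by rw [abs_of_nonneg hC]; exact M.abs_J_le (π i))
      _ = _ := by simp [mul_comm]
  have hb1 : ‖b‖ ≤ H * m := by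
    refine norm_le_of_sum_sq_le (by positivity) ?_
    calc ∑ i, b i ^ 2 ≤ ∑ i, (H * m) ^ 2 * (M.occ (π i) xa.1 xa.2 / tot) := by
          refine Finset.sum_le_sum fun i _ => ?_
          have h0 : 0 ≤ M.occ (π i) xa.1 xa.2 / tot := div_nonneg (hocc i) htot0
          have h1 : M.occ (π i) xa.1 xa.2 / tot ≤ 1 := div_le_one_of_le₀
            (Finset.single_le_sum (fun j _ => hocc j) (Finset.mem_univ i)) htot0
          simp only [hb]
          split_ifs
          · rw [mul_one, mul_div_assoc, ← mul_assoc, mul_pow]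
            exact mul_le_mul_of_nonneg_left (by nlinarith) (sq_nonneg _)
          · rw [mul_zero, sq, mul_zero]
            positivity
      _ = (H * m) ^ 2 * (tot / tot) := by rw [← Finset.mul_sum, ← Finset.sum_div]
      _ ≤ (H * m) ^ 2 := mul_le_of_le_one_right (sq_nonneg _) (div_self_le_one tot)
  rw [hg]
  have h1 := mul_nonneg hC (mul_nonneg hH (Nat.cast_nonneg (α := ℝ) m))
  have h2 := Real.sqrt_nonneg m
  calc ‖a - b‖ ≤ ‖a‖ + ‖b‖ := norm_sub_le _ _
    _ ≤ _ := by nlinarith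

end Subgradient

/-! ### The stochastic subgradient method -/

section SGD

variable (M : MDP X A) (π : Fin m → Policy X A)

/-- The potential of the method relative to a comparator `q`: the penalized cost of the sum of the
iterates minus `t` times that of `q`, plus the squared distance to `q`. -/
def MDP.potential (H ρ : ℝ) (q : EuclideanSpace ℝ (Fin m)) (t : ℕ)
    (s : EuclideanSpace ℝ (Fin m) × EuclideanSpace ℝ (Fin m)) : ℝ :=
  M.penalized π H s.2 - t * M.penalized π H q + ‖s.1 - q‖ ^ 2 / (2 * ρ)

/-- In one round the potential grows at most by the sampling noise of the subgradient in the
direction `θ - q`, plus a constant. -/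
lemma MDP.potential_step_le [NeZero m] {S H ρ : ℝ} (hH : 0 ≤ H) (hρ : 0 < ρ)
    {q : EuclideanSpace ℝ (Fin m)} (hq : q ∈ Theta m S) (t : ℕ)
    (s : EuclideanSpace ℝ (Fin m) × EuclideanSpace ℝ (Fin m)) (xa : Fin X × Fin A) :
    M.potential π H ρ q (t + 1) (projTheta S (s.1 - ρ • M.subgrad π H s.1 xa), s.2 + s.1) ≤
      M.potential π H ρ q t s + ρ * ((1 + M.costBound) * (Real.sqrt m + H * m)) ^ 2 / 2 +
        ((∑ xa', M.avgOcc π xa' * inner ℝ (M.subgrad π H s.1 xa') (s.1 - q)) -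
          inner ℝ (M.subgrad π H s.1 xa) (s.1 - q)) := by
  set g := M.subgrad π H s.1 xa with hg
  have h1 := norm_projTheta_sub_sq_le (S := S) (s.1 - ρ • g) hq
  have h2 : ‖s.1 - ρ • g - q‖ ^ 2 = ‖s.1 - q‖ ^ 2 - 2 * ρ * inner ℝ g (s.1 - q) +
      ρ ^ 2 * ‖g‖ ^ 2 := by
    rw [sub_right_comm, norm_sub_sq_real, inner_smul_right, real_inner_comm, norm_smul,
      Real.norm_of_nonneg hρ.le]
    ring
  have h3 := pow_le_pow_left₀ (norm_nonneg _) (M.norm_subgrad_le π hH s.1 xa) 2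
  rw [← hg] at h3
  have h4 := M.penalized_add_le π hH s.2 s.1
  have h5 := M.penalized_sub_le π hH s.1 q
  have h6 : ‖projTheta S (s.1 - ρ • g) - q‖ ^ 2 / (2 * ρ) ≤ ‖s.1 - q‖ ^ 2 / (2 * ρ) -
      inner ℝ g (s.1 - q) + ρ * ((1 + M.costBound) * (Real.sqrt m + H * m)) ^ 2 / 2 := by
    rw [div_le_iff₀ (by positivity)]
    have h7 : (‖s.1 - q‖ ^ 2 / (2 * ρ) - inner ℝ g (s.1 - q) +
        ρ * ((1 + M.costBound) * (Real.sqrt m + H * m)) ^ 2 / 2) * (2 * ρ) =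
        ‖s.1 - q‖ ^ 2 - 2 * ρ * inner ℝ g (s.1 - q) +
          ρ ^ 2 * ((1 + M.costBound) * (Real.sqrt m + H * m)) ^ 2 := by
      field_simp
    rw [h7]
    have := mul_le_mul_of_nonneg_left h3 (sq_nonneg ρ)
    linarith
  simp only [MDP.potential]
  push_cast
  linarith

variable [NeZero X] [NeZero A] [NeZero m]

/-- The iterates are bounded by `S`; the sum of `t` iterates is bounded by `t S`, and all of them
except the starting point `0` lie on the hyperplane `∑ᵢ θᵢ = 1`. -/
lemma MDP.sgdRounds_support {S : ℝ} (h : (Theta m S).Nonempty) (H ρ : ℝ) (t : ℕ) :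
    ∀ s ∈ (M.sgdRounds π S H ρ t).support, ‖s.1‖ ≤ S ∧ ‖s.2‖ ≤ t * S ∧
      ∑ i, s.1 i = (if t = 0 then 0 else 1) ∧ ∑ i, s.2 i = ((t - 1 : ℕ) : ℝ) := by
  induction t with
  | zero =>
    intro s hs
    rw [MDP.sgdRounds, PMF.mem_support_pure_iff] at hs
    subst hs
    simpa using (radius_pos_of_Theta_nonempty h).le
  | succ t ih =>
    intro s hs
    rw [MDP.sgdRounds, PMF.mem_support_bind_iff] at hs
    obtain ⟨s', hs', hs⟩ := hs
    rw [PMF.mem_support_map_iff] at hs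
    obtain ⟨xa, -, rfl⟩ := hs
    obtain ⟨h1, h2, h3, h4⟩ := ih s' hs'
    have hp := projTheta_mem h (s'.1 - ρ • M.subgrad π H s'.1 xa)
    refine ⟨hp.2, ?_, by simpa using hp.1, ?_⟩
    · push_cast
      exact (norm_add_le _ _).trans (by linarith)
    · simp only [PiLp.add_apply, Finset.sum_add_distrib, h3, h4]
      cases t <;> simp

/-- The exponential moment of the potential, by Hoeffding's lemma in each round. -/
lemma MDP.lexp_exp_potential_le {S H ρ l : ℝ} (hH : 0 ≤ H) (hρ : 0 < ρ) (hl : 0 < l)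
    {q : EuclideanSpace ℝ (Fin m)} (hq : q ∈ Theta m S) (t : ℕ) :
    lexp (M.sgdRounds π S H ρ t)
        (fun s => ENNReal.ofReal (Real.exp (l * M.potential π H ρ q t s))) ≤
      ENNReal.ofReal (Real.exp (l * (S ^ 2 / (2 * ρ)) +
        t * (l * (ρ * ((1 + M.costBound) * (Real.sqrt m + H * m)) ^ 2 / 2) +
          (l * (4 * S * ((1 + M.costBound) * (Real.sqrt m + H * m)))) ^ 2 / 2))) := by
  set G := (1 + M.costBound) * (Real.sqrt m + H * m) with hG
  have hm : (0 : ℝ) < m := Nat.cast_pos.2 (NeZero.pos m)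
  have hC := M.costBound_nonneg
  have hG0 : 0 < G := by
    have := Real.sqrt_pos.2 hm
    positivity
  have hS := radius_pos_of_Theta_nonempty ⟨q, hq⟩
  induction t with
  | zero =>
    rw [MDP.sgdRounds, lexp_pure]
    refine ENNReal.ofReal_le_ofReal (Real.exp_le_exp.2 ?_)
    simp only [MDP.potential, M.penalized_zero, Nat.cast_zero, zero_mul, zero_sub, norm_neg,
      add_zero, neg_zero, zero_add]
    gcongr
    exact hq.2
  | succ t ih =>
    rw [MDP.sgdRounds, lexp_bind]
    simp only [lexp_map]
    have hstep : ∀ s ∈ (M.sgdRounds π S H ρ t).support,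
        lexp (M.sampleLaw π) ((fun s => ENNReal.ofReal
          (Real.exp (l * M.potential π H ρ q (t + 1) s))) ∘ fun xa =>
            (projTheta S (s.1 - ρ • M.subgrad π H s.1 xa), s.2 + s.1)) ≤
        ENNReal.ofReal (Real.exp (l * M.potential π H ρ q t s)) *
          ENNReal.ofReal (Real.exp (l * (ρ * G ^ 2 / 2) + (l * (4 * S * G)) ^ 2 / 2)) := by
      intro s hs
      have hs1 := (M.sgdRounds_support π ⟨q, hq⟩ H ρ t s hs).1
      simp only [Function.comp_def]
      rw [M.lexp_sampleLaw π fun _ => (Real.exp_pos _).le,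
        ← ENNReal.ofReal_mul (Real.exp_pos _).le]
      refine ENNReal.ofReal_le_ofReal ?_
      set ip : Fin X × Fin A → ℝ := fun xa => inner ℝ (M.subgrad π H s.1 xa) (s.1 - q) with hip
      set D : Fin X × Fin A → ℝ := fun xa => l * ((∑ xa', M.avgOcc π xa' * ip xa') - ip xa)
        with hD
      have hw := M.avgOcc_mem π
      have hip_le : ∀ xa, |ip xa| ≤ 2 * S * G := fun xa => by
        calc |ip xa| ≤ ‖M.subgrad π H s.1 xa‖ * ‖s.1 - q‖ := abs_real_inner_le_norm _ _
          _ ≤ G * (S + S) := mul_le_mul (M.norm_subgrad_le π hH s.1 xa)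
              ((norm_sub_le _ _).trans (add_le_add hs1 hq.2)) (norm_nonneg _) hG0.le
          _ = _ := by ring
      have hD0 : ∑ xa, M.avgOcc π xa * D xa = 0 := by
        have h1 : ∀ xa, M.avgOcc π xa * D xa =
            l * ((∑ xa', M.avgOcc π xa' * ip xa') * M.avgOcc π xa - M.avgOcc π xa * ip xa) :=
          fun xa => by simp only [hD]; ring
        simp only [h1]
        rw [← Finset.mul_sum, Finset.sum_sub_distrib, ← Finset.mul_sum, hw.2]
        ring
      have hDB : ∀ xa, |D xa| ≤ l * (4 * S * G) := fun xa => by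
        rw [hD, abs_mul, abs_of_pos hl]
        refine mul_le_mul_of_nonneg_left ((abs_sub _ _).trans ?_) hl.le
        linarith [abs_sum_mul_le hw hip_le, hip_le xa]
      have hexp : ∀ xa, Real.exp (l * M.potential π H ρ q (t + 1)
          (projTheta S (s.1 - ρ • M.subgrad π H s.1 xa), s.2 + s.1)) ≤
          Real.exp (l * M.potential π H ρ q t s + l * (ρ * G ^ 2 / 2)) * Real.exp (D xa) := by
        intro xa
        rw [← Real.exp_add]
        refine Real.exp_le_exp.2 ?_
        have := mul_le_mul_of_nonneg_left (M.potential_step_le π hH hρ hq t s xa) hl.le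
        simp only [hD]
        linarith
      calc _ ≤ ∑ xa, M.avgOcc π xa * (Real.exp (l * M.potential π H ρ q t s +
              l * (ρ * G ^ 2 / 2)) * Real.exp (D xa)) :=
            Finset.sum_le_sum fun xa _ => mul_le_mul_of_nonneg_left (hexp xa) (hw.1 xa)
        _ = Real.exp (l * M.potential π H ρ q t s + l * (ρ * G ^ 2 / 2)) *
              ∑ xa, M.avgOcc π xa * Real.exp (D xa) := by
            rw [Finset.mul_sum]
            exact Finset.sum_congr rfl fun xa _ => by ring
        _ ≤ Real.exp (l * M.potential π H ρ q t s + l * (ρ * G ^ 2 / 2)) *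
              Real.exp ((l * (4 * S * G)) ^ 2 / 2) :=
            mul_le_mul_of_nonneg_left (sum_mul_exp_le hw hD0 hDB (by positivity))
              (Real.exp_pos _).le
        _ = _ := by
            rw [← Real.exp_add, ← Real.exp_add, add_assoc]
    refine (lexp_mono _ hstep).trans ?_
    rw [lexp_mul_const]
    refine (mul_le_mul_left ih _).trans ?_
    rw [← ENNReal.ofReal_mul (Real.exp_pos _).le, ← Real.exp_add]
    refine ENNReal.ofReal_le_ofReal (Real.exp_le_exp.2 (le_of_eq ?_))
    push_cast
    ring

/-- A high-probability regret bound against a fixed comparator, by Markov's inequality. -/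
lemma MDP.toOuterMeasure_sgdRounds_le {S H ρ l δ : ℝ} (hH : 0 ≤ H) (hρ : 0 < ρ) (hl : 0 < l)
    (hδ : 0 < δ) {q : EuclideanSpace ℝ (Fin m)} (hq : q ∈ Theta m S) (T : ℕ) :
    (M.sgdRounds π S H ρ T).toOuterMeasure {s | S ^ 2 / (2 * ρ) +
        T * (ρ * ((1 + M.costBound) * (Real.sqrt m + H * m)) ^ 2 / 2 +
          l * (4 * S * ((1 + M.costBound) * (Real.sqrt m + H * m))) ^ 2 / 2) +
        Real.log (1 / δ) / l < M.penalized π H s.2 - T * M.penalized π H q} ≤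
      ENNReal.ofReal δ := by
  set G := (1 + M.costBound) * (Real.sqrt m + H * m) with hG
  set Z : ℝ := l * (S ^ 2 / (2 * ρ)) +
        T * (l * (ρ * G ^ 2 / 2) + (l * (4 * S * G)) ^ 2 / 2) with hZ
  have h1 := M.lexp_exp_potential_le π hH hρ hl hq T
  refine (toOuterMeasure_le_lexp _ (F := fun s =>
    ENNReal.ofReal (Real.exp (l * M.potential π H ρ q T s)) *
      ENNReal.ofReal (Real.exp (Real.log δ - Z))) fun s hs => ?_).trans ?_
  · rw [← ENNReal.ofReal_mul (Real.exp_pos _).le, ← Real.exp_add, ← ENNReal.ofReal_one]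
    refine ENNReal.ofReal_le_ofReal (Real.one_le_exp ?_)
    have hs' := mul_lt_mul_of_pos_left (show _ < _ from hs) hl
    have h2 : l * (S ^ 2 / (2 * ρ) + T * (ρ * G ^ 2 / 2 + l * (4 * S * G) ^ 2 / 2) +
        Real.log (1 / δ) / l) = Z - Real.log δ := by
      rw [one_div, Real.log_inv, hZ]
      field_simp
      ring
    rw [h2] at hs'
    have h3 : 0 ≤ l * (‖s.1 - q‖ ^ 2 / (2 * ρ)) := by positivity
    simp only [MDP.potential, mul_add]
    linarith
  · rw [lexp_mul_const]
    refine (mul_le_mul_left h1 _).trans ?_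
    rw [← ENNReal.ofReal_mul (Real.exp_pos _).le, ← Real.exp_add]
    refine ENNReal.ofReal_le_ofReal (le_of_eq ?_)
    rw [add_sub_cancel, Real.exp_log hδ]

end SGD

/-! ### The performance of the returned policy -/

/-- The regret constant `m (1 + (1 + C)² + 12 (1 + C))`: the average regret is at most this constant
times `η` if `η ≤ 1`. The learning rate is not tuned to the costs, hence the square of `1 + C`. -/
def regretConst (m C : ℝ) : ℝ := m * (1 + (1 + C) ^ 2 + 12 * (1 + C))

/-- The constant in front of `u/(1-γ) ∨ √(u/(1-γ))` in the performance bound. The first two summands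
bound the excess of the linear cost, the third one accounts for the violation of the output and the
fourth one for the missing weight `1/T`; the last one covers the trivial case `η > 1`. -/
def perfConst (S m C : ℝ) : ℝ :=
  1 + regretConst m C + 3 * C * (2 * (S * m * C) + regretConst m C + 1) + C * m + C * (1 + S * m)

lemma regretConst_nonneg {m C : ℝ} (hm : 0 ≤ m) (hC : 0 ≤ C) : 0 ≤ regretConst m C := by
  rw [regretConst]; positivity

lemma perfConst_nonneg {S m C : ℝ} (hS : 0 ≤ S) (hm : 0 ≤ m) (hC : 0 ≤ C) :
    0 ≤ perfConst S m C := by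
  have := regretConst_nonneg hm hC
  rw [perfConst]; positivity

/-- `perfConst` as a polynomial. -/
def perfPoly : MvPolynomial (Fin 3) ℝ :=
  let s := MvPolynomial.X 0
  let m := MvPolynomial.X 1
  let c := MvPolynomial.X 2
  let r := m * (1 + (1 + c) ^ 2 + MvPolynomial.C 12 * (1 + c))
  1 + r + MvPolynomial.C 3 * c * (MvPolynomial.C 2 * (s * m * c) + r + 1) + c * m + c * (1 + s * m)

lemma eval_perfPoly (S m C : ℝ) : MvPolynomial.eval ![S, m, C] perfPoly = perfConst S m C := by
  simp [perfPoly, perfConst, regretConst]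

/-- The bound of the high-probability regret estimate, for `g = √m + H m`, learning rate
`S / (g √T)`, and the tilting parameter that balances the noise term and the confidence term
`ℓ = log (1/δ)`. It is applied with `k = √(1 + ℓ)` and `e = η²`. -/
lemma regret_le {S g C₁ k ℓ e : ℝ} {T : ℝ} (hS : 0 < S) (hg : 0 < g) (hC : 1 ≤ C₁) (hT : 0 < T)
    (hk : 1 ≤ k) (hℓ : ℓ ≤ k ^ 2) (he : S * k ≤ e * Real.sqrt T) :
    S ^ 2 / (2 * (S / (g * Real.sqrt T))) +
        T * (S / (g * Real.sqrt T) * (C₁ * g) ^ 2 / 2 +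
          k / (4 * S * (C₁ * g) * Real.sqrt T) * (4 * S * (C₁ * g)) ^ 2 / 2) +
        ℓ / (k / (4 * S * (C₁ * g) * Real.sqrt T)) ≤
      T * (e * g * ((1 + C₁ ^ 2) / 2 + 6 * C₁)) := by
  set r := Real.sqrt T with hr
  have hr0 : 0 < r := Real.sqrt_pos.2 hT
  have hTr : T = r ^ 2 := (Real.sq_sqrt hT.le).symm
  have hk0 : 0 < k := by linarith
  have hC0 : 0 < C₁ := by linarith
  rw [hTr]
  have h1 : ℓ / (k / (4 * S * (C₁ * g) * r)) ≤ k * (4 * S * (C₁ * g) * r) := by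
    rw [div_div_eq_mul_div, div_le_iff₀ hk0]
    have : 0 < 4 * S * (C₁ * g) * r := by positivity
    nlinarith
  have h2 : S ^ 2 / (2 * (S / (g * r))) + r ^ 2 * (S / (g * r) * (C₁ * g) ^ 2 / 2 +
      k / (4 * S * (C₁ * g) * r) * (4 * S * (C₁ * g)) ^ 2 / 2) =
      S * g * r * ((1 + C₁ ^ 2) / 2) + S * k * (r * g * (2 * C₁)) := by
    field_simp
    ring
  rw [h2]
  have h3 : S * g * r * ((1 + C₁ ^ 2) / 2) ≤ S * k * (r * g * ((1 + C₁ ^ 2) / 2)) := by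
    have : 0 ≤ S * (r * g * ((1 + C₁ ^ 2) / 2)) := by positivity
    nlinarith
  calc _ ≤ S * k * (r * g * ((1 + C₁ ^ 2) / 2)) + S * k * (r * g * (2 * C₁)) +
        k * (4 * S * (C₁ * g) * r) := by linarith
    _ = S * k * (r * g * ((1 + C₁ ^ 2) / 2 + 6 * C₁)) := by ring
    _ ≤ e * r * (r * g * ((1 + C₁ ^ 2) / 2 + 6 * C₁)) :=
        mul_le_mul_of_nonneg_right he (by positivity)
    _ = _ := by ring

/-- From a small penalized cost to a small cost: `J`, `D`, `V` are the cost of the policy, the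
linear cost and the violation of the output, `D'`, `V'` those of the comparator, and `κ = 1 - γ`. -/
lemma cost_le_of_penalized_le {J D V D' V' S m C κ u η r t : ℝ}
    (hm : 1 ≤ m) (hC : 0 ≤ C) (hS : 0 < S) (hκ : 0 < κ) (hκ1 : κ ≤ 1) (hu : 0 < u)
    (hη : η = Real.sqrt (κ * u)) (hη1 : η ≤ 1) (hr1 : u / κ ≤ r) (hr2 : Real.sqrt (u / κ) ≤ r)
    (hV : 0 ≤ V) (hV' : V' ≤ u) (hD : |D| ≤ S * m * C) (hD' : |D'| ≤ S * m * C)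
    (ht : t ≤ m * η ^ 4)
    (hpen : D + 1 / η * V ≤ D' + 1 / η * V' + regretConst m C * η)
    (hJ : J ≤ D + C * (3 * (V / κ) + t)) :
    J ≤ D' + perfConst S m C * r := by
  have hm0 : 0 ≤ m := by linarith
  have hE := regretConst_nonneg hm0 hC
  set E := regretConst m C with hEdef
  have hη0 : 0 < η := by rw [hη]; exact Real.sqrt_pos.2 (by positivity)
  have hη2 : η * η = κ * u := by rw [hη]; exact Real.mul_self_sqrt (by positivity)
  have hηκ : η / κ = Real.sqrt (u / κ) := by
    have h : u / κ = (η / κ) ^ 2 := by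
      rw [div_pow, sq η, hη2]; field_simp
    rw [h, Real.sqrt_sq (by positivity)]
  have hηr : η ≤ r := by
    refine le_trans ?_ hr2
    rw [← hηκ, le_div_iff₀ hκ]
    nlinarith
  have huη : 1 / η * u = η / κ := by
    field_simp
    rw [sq, hη2]
    ring
  have hur : u ≤ u / κ := by
    rw [le_div_iff₀ hκ]
    nlinarith
  have hpen' : 1 / η * V' ≤ η / κ := by
    rw [← huη]
    exact mul_le_mul_of_nonneg_left hV' (by positivity)
  have hDr : D ≤ D' + (1 + E) * r := by
    have h0 : 0 ≤ 1 / η * V := by positivity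
    have := mul_le_mul_of_nonneg_left hηr hE
    linarith [hηκ ▸ hr2]
  have hVκ : V / κ ≤ (2 * (S * m * C) + E + 1) * r := by
    have h1 : 1 / η * V ≤ 2 * (S * m * C) + η / κ + E * η := by
      linarith [(abs_le.1 hD).1, (abs_le.1 hD').2]
    have h2 : V / κ = η / κ * (1 / η * V) := by field_simp
    have hηκ0 : 0 ≤ η / κ := by positivity
    have h3 := mul_le_mul_of_nonneg_left h1 hηκ0
    have h4 : η / κ * (2 * (S * m * C) + η / κ + E * η) =
        2 * (S * m * C) * (η / κ) + u / κ + E * u := by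
      have h5 : η / κ * (η / κ) = u / κ := by rw [div_mul_div_comm, hη2]; field_simp
      have h6 : η / κ * η = u := by rw [div_mul_eq_mul_div, hη2]; field_simp
      linear_combination h5 + E * h6
    have h7 : 2 * (S * m * C) * (η / κ) ≤ 2 * (S * m * C) * r :=
      mul_le_mul_of_nonneg_left (hηκ ▸ hr2) (by positivity)
    have h8 : E * u ≤ E * r := mul_le_mul_of_nonneg_left (hur.trans hr1) hE
    linarith
  have htr : t ≤ m * r := by
    refine ht.trans (mul_le_mul_of_nonneg_left (le_trans ?_ hηr) hm0)
    exact pow_le_of_le_one hη0.le hη1 (by norm_num)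
  have h9 := mul_le_mul_of_nonneg_left (add_le_add
    (mul_le_mul_of_nonneg_left hVκ (by norm_num : (0:ℝ) ≤ 3)) htr) hC
  have h10 : 0 ≤ C * (1 + S * m) * r := by
    have : 0 ≤ r := hη0.le.trans hηr
    positivity
  rw [perfConst, ← hEdef]
  linarith

lemma MDP.continuous_rate (M : MDP X A) : Continuous M.rate := by
  unfold MDP.rate
  exact (continuous_id.div_const _).max (continuous_id.div_const _).sqrt

lemma MDP.exists_rate_le (M : MDP X A) (K U ε : ℝ) (hU : 0 ≤ U) (hε : 0 < ε) :
    ∃ u, 0 < u ∧ U ≤ u ∧ K * M.rate u ≤ K * M.rate U + ε := by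
  have hc : Continuous fun u => K * M.rate u := continuous_const.mul M.continuous_rate
  obtain ⟨d, hd, h⟩ := Metric.continuous_iff.1 hc U ε hε
  have h1 := h (U + d / 2) (by rw [Real.dist_eq, add_sub_cancel_left, abs_of_pos] <;> linarith)
  rw [Real.dist_eq] at h1
  exact ⟨U + d / 2, by linarith, by linarith, by linarith [(abs_lt.1 h1).2]⟩

lemma MDP.exists_isMinOn_dual (M : MDP X A) (π : Fin m → Policy X A) (w : stdSimplex ℝ (Fin m))
    (K : ℝ) {S : ℝ} (h : (Theta m S).Nonempty) :
    ∃ θ ∈ Theta m S, IsMinOn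
      (fun θ => M.dualGap π w θ + K * M.rate (M.violation π θ)) (Theta m S) θ := by
  refine (isCompact_Theta m S).exists_isMinOn h ?_
  have h1 : ContinuousOn (fun θ => (M.dualCost π θ - M.J (mixture π w)) +
      K * M.rate (M.violation π θ)) (Theta m S) :=
    (((M.continuous_dualCost π).sub continuous_const).add
      (continuous_const.mul (M.continuous_rate.comp (M.continuous_violation π)))).continuousOn
  refine h1.congr fun θ hθ => ?_
  simp only
  rw [← M.J_add_dualGap π w hθ]
  ring

section

variable [NeZero A] [NeZero m] (M : MDP X A) (π : Fin m → Policy X A)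

/-- If the penalized cost of the sum `s` of `T` iterates is at most `T` times that of the comparator
`q`, up to the regret bound, then the policy of the average iterate is nearly as good as `q`. -/
lemma MDP.J_dualPolicy_average_le {S u η : ℝ} {T : ℕ} (hne : (Theta m S).Nonempty) (hu : 0 < u)
    (hη : η = Real.sqrt ((1 - M.γ) * u)) (hTη : S ^ 2 / η ^ 4 ≤ T)
    {q s : EuclideanSpace ℝ (Fin m)} (hq : q ∈ Theta m S) (hqu : M.violation π q ≤ u)
    (hs2 : ‖s‖ ≤ T * S) (hs4 : ∑ i, s i = ((T - 1 : ℕ) : ℝ))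
    (hreg : M.penalized π (1 / η) s - T * M.penalized π (1 / η) q ≤
      T * (η ^ 2 * (Real.sqrt m + 1 / η * m) *
        ((1 + (1 + M.costBound) ^ 2) / 2 + 6 * (1 + M.costBound)))) :
    M.J (M.dualPolicy π ((1 / (T : ℝ)) • s)) ≤
      M.dualCost π q + perfConst S m M.costBound * M.rate u := by
  have hS := radius_pos_of_Theta_nonempty hne
  have hSm := inv_le_sq_of_Theta_nonempty hne
  have hC := M.costBound_nonneg
  have hκ := M.one_sub_γ_pos
  have hκ1 : 1 - M.γ ≤ 1 := by linarith [M.γ_nonneg]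
  have hm : (1 : ℝ) ≤ m := Nat.one_le_cast.2 (NeZero.pos m)
  have hm0 : (0 : ℝ) < m := by linarith
  have hη0 : 0 < η := by rw [hη]; exact Real.sqrt_pos.2 (by positivity)
  have hT0 : (0 : ℝ) < T := lt_of_lt_of_le (by positivity) hTη
  have hTne : T ≠ 0 := fun h => by simp [h] at hT0
  have hsqrtm : Real.sqrt m ≤ m := by
    rw [Real.sqrt_le_left hm0.le]
    nlinarith
  set C₁ := 1 + M.costBound with hC₁
  set g := Real.sqrt m + 1 / η * m with hg
  set θhat : EuclideanSpace ℝ (Fin m) := (1 / (T : ℝ)) • s with hθhat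
  have hs2T : s = (T : ℝ) • θhat := by
    rw [hθhat, smul_smul, mul_one_div_cancel hT0.ne', one_smul]
  have hnorm : ‖θhat‖ ≤ S := by
    rw [hθhat, norm_smul, Real.norm_of_nonneg (by positivity), one_div, inv_mul_le_iff₀ hT0]
    exact hs2
  have hr1 : u / (1 - M.γ) ≤ M.rate u := le_max_left _ _
  have hr2 : Real.sqrt (u / (1 - M.γ)) ≤ M.rate u := le_max_right _ _
  have hDhat := M.abs_dualCost_le π hnorm
  have hDq := M.abs_dualCost_le π hq.2
  rcases le_or_gt η 1 with hη1 | hη1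
  · have hsum : |∑ i, θhat i - 1| = 1 / T := by
      have h1 : ∑ i, θhat i = 1 - 1 / T := by
        simp only [hθhat, PiLp.smul_apply, smul_eq_mul]
        rw [← Finset.mul_sum, hs4, Nat.cast_sub (Nat.one_le_iff_ne_zero.2 hTne)]
        field_simp
        simp
      rw [h1, sub_sub_cancel_left, abs_neg, abs_of_pos (by positivity)]
    refine cost_le_of_penalized_le (D := M.dualCost π θhat) (V := M.violation π θhat)
      (V' := M.violation π q) (t := 1 / T) hm hC hS hκ hκ1 hu hη hη1 hr1 hr2
      (M.violation_nonneg π θhat) hqu hDhat hDq ?_ ?_ ?_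
    · rw [div_le_iff₀ hT0]
      have h1 := hTη
      rw [div_le_iff₀ (by positivity)] at h1
      have h2 : 1 ≤ m * S ^ 2 := by
        rwa [div_le_iff₀ hm0, mul_comm] at hSm
      linarith [mul_le_mul_of_nonneg_left h1 hm0.le]
    · rw [hs2T, M.penalized_smul π _ hT0.le, ← mul_sub] at hreg
      have h1 := le_of_mul_le_mul_left hreg hT0
      have h2 : η ^ 2 * g * ((1 + C₁ ^ 2) / 2 + 6 * C₁) ≤ regretConst m M.costBound * η := by
        have h3 : η ^ 2 * g ≤ 2 * m * η := by
          have h4 : η ^ 2 * g = η * (η * Real.sqrt m) + η * m := by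
            rw [hg]; field_simp
          have h5 : η * Real.sqrt m ≤ m :=
            (mul_le_of_le_one_left (Real.sqrt_nonneg _) hη1).trans hsqrtm
          rw [h4]
          nlinarith
        calc _ ≤ 2 * m * η * ((1 + C₁ ^ 2) / 2 + 6 * C₁) :=
              mul_le_mul_of_nonneg_right h3 (by positivity)
          _ = _ := by rw [regretConst, hC₁]; ring
      simp only [MDP.penalized] at h1
      linarith
    · have h1 := (abs_le.1 (M.abs_J_dualPolicy_sub_le π θhat)).2
      rw [hsum] at h1
      linarith
  · -- for `η > 1` the rate exceeds one and the bound is trivial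
    have h1 : 1 ≤ M.rate u := by
      have h2 : 1 < (1 - M.γ) * u := by
        rw [hη] at hη1
        simpa using (Real.lt_sqrt zero_le_one).1 hη1
      refine le_trans ?_ hr1
      rw [le_div_iff₀ hκ]
      nlinarith
    have h3 := (abs_le.1 (M.abs_J_le (M.dualPolicy π θhat))).2
    have h4 := (abs_le.1 hDq).1
    have h5 : M.costBound * (1 + S * m) ≤ perfConst S m M.costBound := by
      have := regretConst_nonneg hm0.le hC
      rw [perfConst]
      have : 0 ≤ 3 * M.costBound * (2 * (S * m * M.costBound) +
        regretConst m M.costBound + 1) := by positivity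
      have : 0 ≤ M.costBound * m := by positivity
      linarith
    have h6 : perfConst S m M.costBound ≤ perfConst S m M.costBound * M.rate u :=
      le_mul_of_one_le_right (perfConst_nonneg hS.le hm0.le hC) h1
    linarith

variable [NeZero X]

/-- The performance of the returned policy against a fixed comparator. -/
lemma MDP.dualSGD_performance {S u η δ : ℝ} {T : ℕ} (hu : 0 < u)
    (hη : η = Real.sqrt ((1 - M.γ) * u)) (hδ : 0 < δ) (hδ1 : δ < 1) (hT : EnoughRounds S η δ T)
    {q : EuclideanSpace ℝ (Fin m)} (hq : q ∈ Theta m S) (hqu : M.violation π q ≤ u) :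
    ENNReal.ofReal (1 - δ) ≤ (M.dualSGD π S η T).toOuterMeasure
      {θhat | M.J (M.dualPolicy π θhat) ≤
        M.dualCost π q + perfConst S m M.costBound * M.rate u} := by
  have hne : (Theta m S).Nonempty := ⟨q, hq⟩
  have hS := radius_pos_of_Theta_nonempty hne
  have hC := M.costBound_nonneg
  have hκ := M.one_sub_γ_pos
  have hm : (1 : ℝ) ≤ m := Nat.one_le_cast.2 (NeZero.pos m)
  have hm0 : (0 : ℝ) < m := by linarith
  have hη0 : 0 < η := by rw [hη]; exact Real.sqrt_pos.2 (by positivity)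
  have hlog : 0 < Real.log (1 / δ) := Real.log_pos (by rw [lt_div_iff₀ hδ]; linarith)
  refine ofReal_one_sub_le_of_compl _ hδ.le ?_
  rw [MDP.dualSGD, PMF.toOuterMeasure_map_apply]
  set k := Real.sqrt (1 + Real.log (1 / δ)) with hk
  have hk2 : k ^ 2 = 1 + Real.log (1 / δ) := Real.sq_sqrt (by linarith)
  have hk1 : 1 ≤ k := Real.one_le_sqrt.2 (by linarith)
  have hTη : S ^ 2 / η ^ 4 * k ^ 2 ≤ T := by rw [hk2]; exact hT
  have hT0 : (0 : ℝ) < T := lt_of_lt_of_le (by positivity) hTη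
  set C₁ := 1 + M.costBound with hC₁
  set g := Real.sqrt m + 1 / η * m with hg
  have hg0 : 0 < g := by positivity
  have hr0 : 0 < Real.sqrt T := Real.sqrt_pos.2 hT0
  -- this is the square root of the condition on the number of rounds
  have he : S * k ≤ η ^ 2 * Real.sqrt T := by
    refine abs_le_of_sq_le_sq' ?_ (by positivity) |>.2
    rw [mul_pow, mul_pow, Real.sq_sqrt hT0.le, ← pow_mul, show 2 * 2 = 4 from rfl]
    have h := mul_le_mul_of_nonneg_left hTη (by positivity : 0 ≤ η ^ 4)
    have h' : η ^ 4 * (S ^ 2 / η ^ 4 * k ^ 2) = S ^ 2 * k ^ 2 := by field_simp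
    linarith
  have htail := M.toOuterMeasure_sgdRounds_le π (H := 1 / η) (ρ := learningRate m S η T)
    (l := k / (4 * S * (C₁ * g) * Real.sqrt T)) (by positivity)
    (by rw [learningRate]; positivity) (by positivity) hδ hq T
  refine (PMF.toOuterMeasure_mono _ ?_).trans htail
  rintro s ⟨hbad, hs⟩
  obtain ⟨-, hs2, -, hs4⟩ := M.sgdRounds_support π hne _ _ T s hs
  simp only [Set.mem_preimage, Set.mem_compl_iff] at hbad
  rw [Set.mem_ofPred_eq]
  by_contra hcon
  refine hbad ?_
  rw [Set.mem_ofPred_eq]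
  rw [not_lt] at hcon
  rw [learningRate] at hcon
  have hreg := hcon.trans (regret_le hS hg0 (by linarith) hT0 hk1 (by linarith) he)
  exact M.J_dualPolicy_average_le π hne hu hη
    (le_trans (le_mul_of_one_le_right (by positivity) (one_le_pow₀ hk1)) hTη) hq hqu hs2 hs4 hreg

/-- The performance of the returned policy against all parameters with violation at most `u`: it
suffices to compare with the best one of them, which does not depend on the samples. -/
lemma MDP.dualSGD_performance_forall {S u η δ : ℝ} {T : ℕ} (hu : 0 < u)
    (hη : η = Real.sqrt ((1 - M.γ) * u)) (hδ : 0 < δ) (hδ1 : δ < 1) (hT : EnoughRounds S η δ T) :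
    ENNReal.ofReal (1 - δ) ≤ (M.dualSGD π S η T).toOuterMeasure
      {θhat | ∀ θ ∈ Theta m S, M.violation π θ ≤ u → M.J (M.dualPolicy π θhat) ≤
        M.dualCost π θ + perfConst S m M.costBound * M.rate u} := by
  have hcomp : IsCompact (Theta m S ∩ {θ | M.violation π θ ≤ u}) :=
    (isCompact_Theta m S).inter_right (isClosed_le (M.continuous_violation π) continuous_const)
  rcases (Theta m S ∩ {θ | M.violation π θ ≤ u}).eq_empty_or_nonempty with hemp | hne
  · refine ofReal_one_sub_le_of_compl _ hδ.le ?_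
    have : {θhat | ∀ θ ∈ Theta m S, M.violation π θ ≤ u → M.J (M.dualPolicy π θhat) ≤
        M.dualCost π θ + perfConst S m M.costBound * M.rate u}ᶜ =
        (∅ : Set (EuclideanSpace ℝ (Fin m))) := by
      rw [Set.compl_empty_iff]
      refine Set.eq_univ_of_forall fun θhat θ h1 h2 => ?_
      exact absurd (show θ ∈ Theta m S ∩ {θ | M.violation π θ ≤ u} from ⟨h1, h2⟩)
        (by rw [hemp]; exact Set.notMem_empty θ)
    rw [this]
    simp
  · obtain ⟨q, hq, hmin⟩ := hcomp.exists_isMinOn hne (M.continuous_dualCost π).continuousOn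
    refine (M.dualSGD_performance π hu hη hδ hδ1 hT hq.1 hq.2).trans
      (MeasureTheory.measure_mono fun θhat hθhat θ h1 h2 => ?_)
    have h3 : M.dualCost π q ≤ M.dualCost π θ := hmin ⟨h1, h2⟩
    have h4 : M.J (M.dualPolicy π θhat) ≤
        M.dualCost π q + perfConst S m M.costBound * M.rate u := hθhat
    linarith

end

/-! ### Values and step counts of deterministic programs -/

namespace Timed

@[simp] lemma bind_val {β β' : Type} (x : Timed β) (f : β → Timed β') :
    (x >>= f).val = (f x.val).val := rfl

@[simp] lemma bind_steps {β β' : Type} (x : Timed β) (f : β → Timed β') :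
    (x >>= f).steps = x.steps + (f x.val).steps := rfl

@[simp] lemma pure_val {β : Type} (b : β) : (pure b : Timed β).val = b := rfl

@[simp] lemma pure_steps {β : Type} (b : β) : (pure b : Timed β).steps = 0 := rfl

lemma tabulate_steps_le {β : Type} {n b : ℕ} {f : Fin n → Timed β}
    (h : ∀ i, (f i).steps ≤ b) : (tabulate f).steps ≤ n * (b + 1) := by
  change ∑ i, ((f i).steps + 1) ≤ _
  refine (Finset.sum_le_sum fun i _ => Nat.succ_le_succ (h i)).trans ?_
  simp

lemma sum_steps_le {n b : ℕ} {f : Fin n → Timed ℝ}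
    (h : ∀ i, (f i).steps ≤ b) : (sum f).steps ≤ n * (b + 1) := by
  change ∑ i, ((f i).steps + 1) ≤ _
  refine (Finset.sum_le_sum fun i _ => Nat.succ_le_succ (h i)).trans ?_
  simp

lemma loop_succ {σ : Type} (n : ℕ) (body : Fin (n + 1) → σ → Timed σ) (s : σ) :
    loop (n + 1) body s =
      (do tick; body 0 s : Timed σ) >>= loop n fun k => body k.succ := by
  simp only [loop, List.finRange_succ, List.foldlM_cons, List.foldlM_map]
  rfl

/-- A property indexed by the number of completed iterations and preserved by the body of a loop
holds at its end. -/
lemma loop_invariant {σ : Type} (I : ℕ → σ → Prop) {n : ℕ} {body : Fin n → σ → Timed σ} {s : σ}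
    (h0 : I 0 s) (h : ∀ (k : Fin n) s, I k s → I (k + 1) (body k s).val) :
    I n (loop n body s).val := by
  induction n generalizing s I with
  | zero => exact h0
  | succ n ih =>
    rw [loop_succ]
    exact ih (fun k => I (k + 1)) (h 0 s h0) fun k s hk => h k.succ s (by simpa using hk)

lemma loop_steps_le {σ : Type} {n b : ℕ} {body : Fin n → σ → Timed σ} (s : σ)
    (h : ∀ k s, (body k s).steps ≤ b) : (loop n body s).steps ≤ n * (b + 1) := by
  induction n generalizing s with
  | zero => exact Nat.zero_le _
  | succ n ih =>
    rw [loop_succ, bind_steps, bind_steps]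
    have h1 := ih (body := fun k => body k.succ) (body 0 s).val fun k => h k.succ
    have h2 := h 0 s
    have h3 : tick.steps = 1 := rfl
    rw [h3, add_one_mul]
    exact (add_le_add (add_le_add_right h2 1) h1).trans (by omega)

end Timed

open Timed

/-! ### Gauss-Jordan elimination -/

lemma eliminate_val {n : ℕ} (k : Fin n) (B : Fin n → Fin (n + 1) → ℝ) (i : Fin n)
    (j : Fin (n + 1)) : (eliminate k B).val i j =
      if i = k then B k j / B k k.castSucc
      else B i j - B i k.castSucc / B k k.castSucc * B k j := by
  simp only [eliminate, tabulate, bind_val]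
  split_ifs <;> rfl

/-- The invariant of Gauss-Jordan elimination after `k` steps, for a system with solution `ν` whose
matrix has non-positive off-diagonal entries and positive column sums. The first `k` columns are
those of the identity matrix, and the block of the remaining rows and columns inherits the
sign conditions, which make the next pivot positive. -/
structure EliminationInvariant {n : ℕ} (ν : Fin n → ℝ) (k : ℕ) (B : Fin n → Fin (n + 1) → ℝ) :
    Prop where
  unit_columns : ∀ i j : Fin n, (j : ℕ) < k → B i j.castSucc = if i = j then 1 else 0
  offDiag_nonpos : ∀ i j : Fin n, k ≤ i → k ≤ j → i ≠ j → B i j.castSucc ≤ 0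
  colSum_pos : ∀ j : Fin n, k ≤ j →
    0 < ∑ i ∈ Finset.univ.filter fun i : Fin n => k ≤ (i : ℕ), B i j.castSucc
  solution : ∀ i, ∑ j : Fin n, B i j.castSucc * ν j = B i (Fin.last n)

lemma EliminationInvariant.eliminate {n : ℕ} {ν : Fin n → ℝ} {k : Fin n}
    {B : Fin n → Fin (n + 1) → ℝ} (h : EliminationInvariant ν k B) :
    EliminationInvariant ν (k + 1) (eliminate k B).val := by
  have hfilter : (Finset.univ.filter fun i : Fin n => (k : ℕ) ≤ i) =
      insert k (Finset.univ.filter fun i : Fin n => (k : ℕ) + 1 ≤ i) := by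
    ext i
    simp only [Finset.mem_filter, Finset.mem_univ, true_and, Finset.mem_insert, Fin.ext_iff]
    omega
  set R := Finset.univ.filter fun i : Fin n => (k : ℕ) + 1 ≤ i with hR
  have hnot : k ∉ R := by simp [hR]
  have hmem : ∀ i ∈ R, (k : ℕ) + 1 ≤ i := fun i hi => by simpa [hR] using hi
  have hsum : ∀ j : Fin n, (k : ℕ) ≤ j →
      0 < B k j.castSucc + ∑ i ∈ R, B i j.castSucc := by
    intro j hj
    have := h.colSum_pos j hj
    rwa [hfilter, Finset.sum_insert hnot] at this
  have hcol : ∑ i ∈ R, B i k.castSucc ≤ 0 := by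
    refine Finset.sum_nonpos fun i hi => ?_
    have hi' := hmem i hi
    exact h.offDiag_nonpos i k (by omega) le_rfl (fun hik => by rw [hik] at hi'; omega)
  have hpiv : 0 < B k k.castSucc := by linarith [hsum k le_rfl]
  refine ⟨fun i j hj => ?_, fun i j hi hj hij => ?_, fun j hj => ?_, fun i => ?_⟩
  · rw [eliminate_val]
    rcases Nat.lt_succ_iff_lt_or_eq.1 hj with hj | hj
    · have hkj : k ≠ j := fun hkj => by rw [hkj] at hj; omega
      rw [h.unit_columns k j hj, if_neg hkj, h.unit_columns i j hj]
      by_cases hik : i = k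
      · rw [if_pos hik, hik, if_neg hkj, zero_div]
      · rw [if_neg hik, mul_zero, sub_zero]
    · have hjk : j = k := Fin.ext hj
      subst hjk
      split_ifs with hij
      · exact div_self hpiv.ne'
      · rw [div_mul_cancel₀ _ hpiv.ne', sub_self]
  · have hik : i ≠ k := fun hik => by rw [hik] at hi; omega
    have hjk : k ≠ j := fun hjk => by rw [← hjk] at hj; omega
    rw [eliminate_val, if_neg hik]
    have h1 := h.offDiag_nonpos i j (by omega) (by omega) hij
    have h2 := h.offDiag_nonpos i k (by omega) le_rfl hik
    have h3 := h.offDiag_nonpos k j le_rfl (by omega) hjk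
    have h4 := mul_nonneg_of_nonpos_of_nonpos (div_nonpos_of_nonpos_of_nonneg h2 hpiv.le) h3
    linarith
  · -- the new column sum is the old one without the pivot row, plus a multiple of the entry of the
    -- pivot row, which is non-positive; the factor is at most one by the column sum of the pivot
    have hjk : k ≠ j := fun hjk => by rw [← hjk] at hj; omega
    have h1 : ∑ i ∈ R, (DualMDP.eliminate k B).val i j.castSucc =
        ∑ i ∈ R, B i j.castSucc -
          (∑ i ∈ R, B i k.castSucc) / B k k.castSucc *
            B k j.castSucc := by
      rw [Finset.sum_div, Finset.sum_mul, ← Finset.sum_sub_distrib]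
      refine Finset.sum_congr rfl fun i hi => ?_
      have hi' := hmem i hi
      rw [eliminate_val, if_neg fun hik => by rw [hik] at hi'; omega]
    rw [h1]
    have h2 := hsum j (by omega)
    have h3 := h.offDiag_nonpos k j le_rfl (by omega) hjk
    have h4 : -1 ≤ (∑ i ∈ R, B i k.castSucc) / B k k.castSucc := by
      rw [le_div_iff₀ hpiv]
      linarith [hsum k le_rfl]
    nlinarith
  · simp only [eliminate_val]
    split_ifs with hik
    · rw [← h.solution k, Finset.sum_div]
      exact Finset.sum_congr rfl fun j _ => by ring
    · rw [← h.solution k, ← h.solution i, Finset.mul_sum, ← Finset.sum_sub_distrib]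
      exact Finset.sum_congr rfl fun j _ => by ring

lemma solve_val {n : ℕ} {ν : Fin n → ℝ} {B : Fin n → Fin (n + 1) → ℝ}
    (h : EliminationInvariant ν 0 B) : (solve B).val = ν := by
  have h1 := loop_invariant (EliminationInvariant ν) (body := eliminate) h
    fun k s hk => hk.eliminate
  funext i
  have h2 := h1.solution i
  rw [Finset.sum_congr rfl fun j _ => by rw [h1.unit_columns i j j.2]] at h2
  change (loop n eliminate B).val i (Fin.last n) = ν i
  simpa using h2.symm

lemma solve_steps_le {n : ℕ} (B : Fin n → Fin (n + 1) → ℝ) :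
    (solve B).steps ≤ n * (n * ((n + 1) * 5 + 1) + 1) + n := by
  rw [solve, bind_steps]
  refine add_le_add (loop_steps_le _ fun k s => tabulate_steps_le fun i => tabulate_steps_le
    fun j => ?_) ((tabulate_steps_le (b := 0) fun i => le_rfl).trans (by simp))
  rw [bind_steps]
  change 1 + _ ≤ 4
  split_ifs
  · exact Nat.le_add_left 2 2
  · exact le_rfl

/-- The linear system `(I - γ P_πᵀ) ν = (1-γ) α` has the state occupancy measure as a solution, and
its matrix has non-positive off-diagonal entries and column sums `1 - γ`. -/
lemma eliminationInvariant_flow (M : MDP X A) (p : Policy X A) {B : Fin X → Fin (X + 1) → ℝ}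
    (hB : ∀ y x : Fin X, B y x.castSucc = (if y = x then 1 else 0) - M.γ * M.chain p x y)
    (hlast : ∀ y, B y (Fin.last X) = (1 - M.γ) * M.α y) :
    EliminationInvariant (M.stateOcc p) 0 B := by
  have hP := M.chain_mem p
  refine ⟨fun i j hj => absurd hj (Nat.not_lt_zero _), fun i j _ _ hij => ?_, fun j _ => ?_,
    fun i => ?_⟩
  · rw [hB, if_neg hij, zero_sub, neg_nonpos]
    exact mul_nonneg M.γ_nonneg (Matrix.nonneg_of_mem_rowStochastic hP)
  · simp only [Nat.zero_le, Finset.filter_true, hB, Finset.sum_sub_distrib, ← Finset.mul_sum,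
      Matrix.sum_row_of_mem_rowStochastic hP]
    simpa using M.γ_mem.2
  · rw [hlast]
    simp only [hB, sub_mul, Finset.sum_sub_distrib]
    have h1 : ∑ x, M.γ * M.chain p x i * M.stateOcc p x =
        M.γ * ∑ x, M.stateOcc p x * M.chain p x i := by
      rw [Finset.mul_sum]
      exact Finset.sum_congr rfl fun x _ => by ring
    have h2 := M.stateOcc_eq p i
    rw [h1]
    simp only [ite_mul, one_mul, zero_mul, Finset.sum_ite_eq, Finset.mem_univ, if_true]
    linarith

lemma progOcc_val (M : MDP X A) (p : Policy X A) : (progOcc M p).val = M.occ p := by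
  funext x a
  simp only [progOcc, bind_val]
  rw [solve_val (eliminationInvariant_flow M p ?_ ?_)]
  · rfl
  · intro y x
    have hx : (x.castSucc : ℕ) < X := x.2
    change _ = _ - M.γ * ∑ a, p.prob x a * M.P x a y
    simp only [tabulate, bind_val]
    rw [dif_pos hx]
    simp [Timed.sub, Timed.mul, Timed.nat, Timed.sum, Fin.ext_iff]
  · intro y
    simp only [tabulate, bind_val]
    rw [dif_neg (by simp)]
    simp [Timed.sub, Timed.mul, Timed.nat]

lemma progOcc_steps_le (M : MDP X A) (p : Policy X A) :
    (progOcc M p).steps ≤ X * (X * (A * 2 + 1) + 1) + (X * ((X + 1) * 5 + 1) +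
      ((X * (X * ((X + 1) * 5 + 1) + 1) + X) + X * (A * 2 + 1))) := by
  rw [progOcc, bind_steps, bind_steps, bind_steps]
  refine add_le_add (tabulate_steps_le fun x => tabulate_steps_le fun y =>
      sum_steps_le (b := 1) fun a => le_rfl)
    (add_le_add (tabulate_steps_le fun y => tabulate_steps_le fun j => ?_)
      (add_le_add (solve_steps_le _)
        (tabulate_steps_le fun x => tabulate_steps_le (b := 1) fun a => le_rfl)))
  rw [bind_steps]
  change 1 + _ ≤ 4
  split_ifs <;> exact le_rfl

/-! ### The deterministic parts of a round -/

lemma progProj_val (S : ℝ) (y : Fin m → ℝ) : (progProj S y).val = shrinkProj S y := by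
  simp only [progProj, shrinkProj, bind_val, Timed.lt, Timed.nat, Timed.div, Timed.sum, Timed.sub,
    Timed.add, Timed.mul, Timed.sqrt, tabulate, pure_val, Nat.cast_one, decide_eq_true_eq]
  split_ifs <;> rfl

lemma progProj_steps_le (S : ℝ) (y : Fin m → ℝ) : (progProj S y).steps ≤ 10 * m + 10 := by
  simp only [progProj, bind_steps]
  split_ifs <;> simp [Timed.lt, Timed.nat, Timed.div, Timed.sum, Timed.sub,
    Timed.add, Timed.mul, Timed.sqrt, tabulate] <;> omega

lemma progSubgrad_val (M : MDP X A) (π : Fin m → Policy X A) (H : ℝ)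
    (θ : EuclideanSpace ℝ (Fin m)) (xa : Fin X × Fin A) :
    (progSubgrad (fun i => M.occ (π i)) (fun j => ∑ x, ∑ a, M.c x a * M.occ (π j) x a) H θ
      xa.1 xa.2).val = M.subgrad π H θ xa := by
  simp only [progSubgrad, MDP.subgrad, MDP.xi, bind_val, Timed.lt, Timed.nat, Timed.sum, Timed.mul,
    Nat.cast_zero, decide_eq_true_eq]
  split_ifs <;> funext j <;> simp [tabulate, Timed.sub, Timed.div]

lemma progSubgrad_steps_le (occ : Fin m → Fin X → Fin A → ℝ) (cM : Fin m → ℝ) (H : ℝ)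
    (θ : Fin m → ℝ) (x : Fin X) (a : Fin A) :
    (progSubgrad occ cM H θ x a).steps ≤ 8 * m + 3 := by
  simp only [progSubgrad, bind_steps]
  split_ifs <;> simp [Timed.lt, Timed.nat, Timed.div, Timed.sum, Timed.sub,
    Timed.mul, tabulate] <;> omega

lemma progPolicy_val [NeZero A] (M : MDP X A) (π : Fin m → Policy X A)
    (θ : EuclideanSpace ℝ (Fin m)) :
    (progPolicy (fun i => M.occ (π i)) θ).val = (M.dualPolicy π θ).prob := by
  have hpos : ∀ ξ : ℝ, (if 0 < ξ then (pure ξ : Timed ℝ) else pure 0).val = max ξ 0 := by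
    intro ξ
    split_ifs with h
    · exact (max_eq_left h.le).symm
    · exact (max_eq_right (not_lt.1 h)).symm
  funext x a
  simp only [progPolicy, MDP.dualPolicy, normalizePos, MDP.xi, bind_val, Timed.lt, Timed.nat,
    Timed.sum, Timed.mul, Timed.div, tabulate, Nat.cast_zero, Nat.cast_one, decide_eq_true_eq,
    pure_val, hpos]
  by_cases h : ∀ a', ∑ i, θ i * M.occ (π i) x a' ≤ 0
  · have h0 : ∑ a', max (∑ i, θ i * M.occ (π i) x a') 0 = 0 :=
      Finset.sum_eq_zero fun a' _ => max_eq_right (h a')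
    rw [if_pos h, h0, if_neg (lt_irrefl _)]
    rfl
  · rw [if_neg h]
    push Not at h
    obtain ⟨a', ha'⟩ := h
    rw [if_pos]
    exact Finset.sum_pos' (fun i _ => le_max_right _ _)
      ⟨a', Finset.mem_univ a', lt_max_of_lt_left ha'⟩

lemma progPolicy_steps_le (occ : Fin m → Fin X → Fin A → ℝ) (θ : Fin m → ℝ) :
    (progPolicy occ θ).steps ≤ X * (1 + (A * (m * 2 + 1 + 1) + (A + (1 + (A * 2 + 2)))) + 1) := by
  refine tabulate_steps_le fun x => ?_
  simp only [bind_steps]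
  refine add_le_add le_rfl (add_le_add (tabulate_steps_le fun a => ?_) (add_le_add
    ((sum_steps_le (b := 0) fun a => le_rfl).trans (by simp)) (add_le_add le_rfl ?_)))
  · refine add_le_add (sum_steps_le (b := 1) fun i => le_rfl) ?_
    rw [bind_steps]
    split_ifs <;> exact le_rfl
  · split_ifs
    · exact (tabulate_steps_le (b := 1) fun a => le_rfl).trans (by omega)
    · simp only [bind_steps]
      have : (tabulate fun _ : Fin A => Timed.div (Timed.nat 1).val (Timed.nat A).val).steps ≤
          A * 2 := tabulate_steps_le (b := 1) fun a => le_rfl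
      change 1 + (1 + _) ≤ _
      omega

/-! ### Laws and step counts of randomized programs -/

namespace Prog

/-- The law of the result of a randomized program. -/
def law {β : Type} (x : Prog β) : PMF β := PMF.map (fun r : Timed β => r.val) x

/-- All runs of a randomized program take at most `b` steps. -/
def StepsLe {β : Type} (x : Prog β) (b : ℕ) : Prop :=
  ∀ r ∈ PMF.support (x : PMF (Timed β)), r.steps ≤ b

lemma map_val_bind {β β' : Type} (x : PMF (Timed β)) (f : β → PMF (Timed β')) :
    PMF.map (fun r : Timed β' => r.val) (x.bind fun r =>
      PMF.map (fun r' : Timed β' => (⟨r'.val, r.steps + r'.steps⟩ : Timed β')) (f r.val)) =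
      (PMF.map (fun r : Timed β => r.val) x).bind fun v =>
        PMF.map (fun r : Timed β' => r.val) (f v) := by
  rw [PMF.map_bind, PMF.bind_map]
  congr 1
  funext r
  rw [PMF.map_comp]
  rfl

lemma law_bind {β β' : Type} (x : Prog β) (f : β → Prog β') :
    law (x >>= f) = (law x).bind fun v => law (f v) :=
  map_val_bind x f

lemma law_det {β : Type} (t : Timed β) : law (det t) = PMF.pure t.val := PMF.pure_map _ _

lemma law_pure {β : Type} (b : β) : law (pure b) = PMF.pure b := PMF.pure_map _ _

lemma law_drawUniform (n : ℕ) [NeZero n] :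
    law (drawUniform n) = PMF.uniformOfFintype (Fin n) := by
  change PMF.map _ (PMF.map _ _) = _
  rw [PMF.map_comp]
  exact PMF.map_id _

lemma law_drawTable [NeZero X] [NeZero A] (p : Fin X → Fin A → ℝ) :
    law (drawTable p) = discreteLaw fun xa : Fin X × Fin A => p xa.1 xa.2 := by
  change PMF.map _ (PMF.map _ _) = _
  rw [PMF.map_comp]
  exact PMF.map_id _

lemma StepsLe.bind {β β' : Type} {x : Prog β} {f : β → Prog β'} {a b : ℕ} (hx : StepsLe x a)
    (hf : ∀ v, StepsLe (f v) b) : StepsLe (x >>= f) (a + b) := by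
  intro r hr
  change r ∈ (PMF.bind x fun r => PMF.map _ (f r.val)).support at hr
  obtain ⟨r₁, h1, hr⟩ := (PMF.mem_support_bind_iff _ _ _).1 hr
  obtain ⟨r₂, h2, rfl⟩ := (PMF.mem_support_map_iff _ _ _).1 hr
  exact add_le_add (hx r₁ h1) (hf _ r₂ h2)

lemma StepsLe.det {β : Type} {t : Timed β} {b : ℕ} (h : t.steps ≤ b) : StepsLe (det t) b := by
  intro r hr
  rw [(PMF.mem_support_pure_iff _ _).1 hr]
  exact h

lemma StepsLe.pure {β : Type} (v : β) : StepsLe (Pure.pure v) 0 := by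
  intro r hr
  rw [(PMF.mem_support_pure_iff _ _).1 hr]

lemma stepsLe_drawUniform (n : ℕ) [NeZero n] : StepsLe (drawUniform n) 1 := by
  intro r hr
  obtain ⟨i, -, rfl⟩ := (PMF.mem_support_map_iff _ _ _).1 hr
  exact le_rfl

lemma stepsLe_drawTable [NeZero X] [NeZero A] (p : Fin X → Fin A → ℝ) :
    StepsLe (drawTable p) (X * A) := by
  intro r hr
  obtain ⟨i, -, rfl⟩ := (PMF.mem_support_map_iff _ _ _).1 hr
  exact le_rfl

lemma StepsLe.mono {β : Type} {x : Prog β} {a b : ℕ} (hx : StepsLe x a) (h : a ≤ b) :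
    StepsLe x b := fun r hr => (hx r hr).trans h

end Prog

/-! ### The randomized algorithm as a program -/

section

variable [NeZero X] [NeZero A] [NeZero m]

lemma law_progRounds (M : MDP X A) (π : Fin m → Policy X A) {S : ℝ} (h : (Theta m S).Nonempty)
    (H ρ : ℝ) (t : ℕ) :
    Prog.law (progRounds (fun i => M.occ (π i)) (fun j => ∑ x, ∑ a, M.c x a * M.occ (π j) x a)
      S H ρ t) = PMF.map (fun s => (WithLp.ofLp s.1, WithLp.ofLp s.2)) (M.sgdRounds π S H ρ t) := by
  induction t with
  | zero =>
    rw [progRounds, Prog.law_det, MDP.sgdRounds, PMF.pure_map]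
    congr 1
    simp only [bind_val, pure_val, tabulate, Timed.nat, Nat.cast_zero]
    rfl
  | succ t ih =>
    rw [progRounds, Prog.law_bind, ih, PMF.bind_map, MDP.sgdRounds, PMF.map_bind]
    congr 1
    funext s
    rw [Function.comp_apply, Prog.law_bind, Prog.law_drawUniform, MDP.sampleLaw, PMF.map_comp,
      PMF.map_bind]
    congr 1
    funext i
    rw [Prog.law_bind, Prog.law_drawTable, PMF.map]
    congr 1
    funext xa
    rw [Prog.law_det, Function.comp_apply]
    congr 1
    simp only [bind_val, pure_val, progProj_val, progSubgrad_val, Function.comp_apply,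
      projTheta_eq h]
    rfl

lemma stepsLe_progRounds (occ : Fin m → Fin X → Fin A → ℝ) (cM : Fin m → ℝ) (S H ρ : ℝ) (t : ℕ) :
    Prog.StepsLe (progRounds occ cM S H ρ t) (4 * m + t * (X * A + 23 * m + 15)) := by
  induction t with
  | zero =>
    refine Prog.StepsLe.det ?_
    simp only [bind_steps]
    simp [tabulate, Timed.nat]
    omega
  | succ t ih =>
    refine (ih.bind fun st => (Prog.stepsLe_drawUniform m).bind fun i =>
      (Prog.stepsLe_drawTable (occ i)).bind fun xa => Prog.StepsLe.det (b := 23 * m + 14) ?_).mono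
        (by rw [add_one_mul]; omega)
    simp only [bind_steps, pure_steps]
    have h1 := progSubgrad_steps_le occ cM H st.1 xa.1 xa.2
    have h2 := progProj_steps_le S (tabulate fun j => do
        let r ← mul ρ ((progSubgrad occ cM H st.1 xa.1 xa.2).val j)
        Timed.sub (st.1 j) r).val
    have h3 : (tabulate fun j => do
        let r ← mul ρ ((progSubgrad occ cM H st.1 xa.1 xa.2).val j)
        Timed.sub (st.1 j) r).steps ≤ m * 3 := tabulate_steps_le (b := 2) fun j => le_rfl
    have h4 : (tabulate fun j => Timed.add (st.2 j) (st.1 j)).steps ≤ m * 2 :=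
      tabulate_steps_le (b := 1) fun j => le_rfl
    have h5 : tick.steps = 1 := rfl
    omega

lemma law_program (M : MDP X A) (π : Fin m → Policy X A) {S : ℝ} (h : (Theta m S).Nonempty)
    (η : ℝ) (T : ℕ) :
    Prog.law (program M π S η T) =
      PMF.map (fun θ => (WithLp.ofLp θ, (M.dualPolicy π θ).prob)) (M.dualSGD π S η T) := by
  have hocc : (tabulate fun i => progOcc M (π i)).val = fun i => M.occ (π i) :=
    funext fun i => progOcc_val M (π i)
  have hH : (do let one ← Timed.nat 1; Timed.div one η : Timed ℝ).val = 1 / η := by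
    simp [Timed.nat, Timed.div]
  rw [program]
  simp only [Prog.law_bind, Prog.law_det, Prog.law_pure, PMF.pure_bind, hocc, hH]
  have hc : (tabulate fun j => Timed.sum fun x => Timed.sum fun a =>
      mul (M.c x a) (M.occ (π j) x a)).val = fun j => ∑ x, ∑ a, M.c x a * M.occ (π j) x a := rfl
  rw [hc]
  change PMF.bind (Prog.law (progRounds _ _ S (1 / η) (learningRate m S η T) T)) _ = _
  rw [law_progRounds M π h, PMF.bind_map, MDP.dualSGD, PMF.map_comp, PMF.map]
  congr 1
  funext s
  simp only [Function.comp_apply]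
  have hθ : (tabulate fun j => Timed.div (WithLp.ofLp s.2 j) (Timed.nat T).val).val =
      WithLp.ofLp ((1 / (T : ℝ)) • s.2) := by
    funext j
    simp [tabulate, Timed.div, Timed.nat, div_eq_inv_mul]
  rw [hθ, progPolicy_val]

lemma program_steps_le {X A m T : ℕ} (hX : 0 < X) (hA : 0 < A) (hm : 0 < m) (hT : 0 < T) :
    m * (X * (X * (A * 2 + 1) + 1) + (X * ((X + 1) * 5 + 1) +
        ((X * (X * ((X + 1) * 5 + 1) + 1) + X) + X * (A * 2 + 1))) + 1) +
      (m * (X * (A * 2 + 1) + 1) + (1 + (2 + (7 + ((4 * m + T * (X * A + 23 * m + 15)) +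
        (m * 2 + (X * (1 + (A * (m * 2 + 1 + 1) + (A + (1 + (A * 2 + 2)))) + 1) + 0))))))) ≤
      200 * X ^ 3 * A * (m * T) := by
  obtain ⟨x, rfl⟩ := Nat.exists_eq_add_of_le' hX
  obtain ⟨a, rfl⟩ := Nat.exists_eq_add_of_le' hA
  obtain ⟨k, rfl⟩ := Nat.exists_eq_add_of_le' hm
  obtain ⟨t, rfl⟩ := Nat.exists_eq_add_of_le' hT
  -- in the shifted variables all coefficients of the difference are non-negative
  zify
  rw [← sub_nonneg]
  ring_nf
  positivity

/-- The step count of the whole program, added up from its parts. -/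
lemma stepsLe_program (M : MDP X A) (π : Fin m → Policy X A) (S η : ℝ) (T : ℕ) :
    Prog.StepsLe (program M π S η T)
      (m * (X * (X * (A * 2 + 1) + 1) + (X * ((X + 1) * 5 + 1) +
        ((X * (X * ((X + 1) * 5 + 1) + 1) + X) + X * (A * 2 + 1))) + 1) +
      (m * (X * (A * 2 + 1) + 1) + (1 + (2 + (7 + ((4 * m + T * (X * A + 23 * m + 15)) +
        (m * 2 + (X * (1 + (A * (m * 2 + 1 + 1) + (A + (1 + (A * 2 + 2)))) + 1) + 0)))))))) := by
  refine (Prog.StepsLe.det (tabulate_steps_le fun i => progOcc_steps_le M (π i))).bind fun occ =>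
    (Prog.StepsLe.det (tabulate_steps_le fun j => sum_steps_le fun x =>
      sum_steps_le (b := 1) fun a => le_rfl)).bind fun cM =>
    (Prog.StepsLe.det le_rfl).bind fun T' => (Prog.StepsLe.det le_rfl).bind fun H =>
    (Prog.StepsLe.det le_rfl).bind fun ρ => (stepsLe_progRounds occ cM S H ρ T).bind fun st =>
    (Prog.StepsLe.det (tabulate_steps_le (b := 1) fun j => le_rfl)).bind fun θ =>
    (Prog.StepsLe.det (progPolicy_steps_le occ θ)).bind fun p => Prog.StepsLe.pure _

end

end

end DualMDP

open DualMDP in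
theorem mainTheorem4 :
    -- performance of the returned policy; the constant hidden in the big-O is a polynomial in
    -- the radius `S`, the number `m` of base policies and the bound on the costs
    (∃ K : MvPolynomial (Fin 3) ℝ,
      ∀ (X A m : ℕ) [NeZero X] [NeZero A] [NeZero m] (M : MDP X A) (π : Fin m → Policy X A)
        (S : ℝ), (Theta m S).Nonempty →
        -- the minimum over mixtures is attained
        (∃ wstar, IsOptimalMixture M π wstar) ∧
        ∀ wstar, IsOptimalMixture M π wstar →
          -- the minimum over the dual parameters is attained
          (∃ θstar ∈ Theta m S, IsMinOn
            (fun θ => M.dualGap π wstar θ +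
              MvPolynomial.eval ![S, (m : ℝ), M.costBound] K * M.rate (M.violation π θ))
            (Theta m S) θstar) ∧
          -- the bound for the tuning `η = √((1-γ)u)`, simultaneously for all `θ` with `U(θ) ≤ u`
          (∀ (u η δ : ℝ) (T : ℕ), 0 < u → η = Real.sqrt ((1 - M.γ) * u) → 0 < δ → δ < 1 →
            EnoughRounds S η δ T →
            ENNReal.ofReal (1 - δ) ≤ (M.dualSGD π S η T).toOuterMeasure
              {θhat | ∀ θ ∈ Theta m S, M.violation π θ ≤ u →
                M.J (M.dualPolicy π θhat) ≤ M.J (mixture π wstar) + (M.dualGap π wstar θ +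
                  MvPolynomial.eval ![S, (m : ℝ), M.costBound] K * M.rate u)}) ∧
          -- the bound with the minimum over all of `Θ`, up to an arbitrarily small error
          (∀ ε : ℝ, 0 < ε → ∃ η : ℝ, 0 < η ∧ ∀ (δ : ℝ) (T : ℕ), 0 < δ → δ < 1 →
            EnoughRounds S η δ T →
            ENNReal.ofReal (1 - δ) ≤ (M.dualSGD π S η T).toOuterMeasure
              {θhat | ∀ θ ∈ Theta m S,
                M.J (M.dualPolicy π θhat) ≤ M.J (mixture π wstar) + (M.dualGap π wstar θ +
                  MvPolynomial.eval ![S, (m : ℝ), M.costBound] K * M.rate (M.violation π θ))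
                  + ε})) ∧
    -- running time of the algorithm
    (∃ p q : Polynomial ℕ,
      ∀ (X A m : ℕ) [NeZero X] [NeZero A] [NeZero m] (M : MDP X A) (π : Fin m → Policy X A)
        (S η : ℝ) (T : ℕ), (Theta m S).Nonempty → 0 < η → 0 < T →
        -- the program has the output law of the algorithm
        PMF.map (fun r => r.val) (program M π S η T) =
          PMF.map (fun θ => (WithLp.ofLp θ, (M.dualPolicy π θ).prob)) (M.dualSGD π S η T) ∧
        ∀ r ∈ PMF.support (program M π S η T),
          r.steps ≤ p.eval X * A * (q.eval m * T)) := by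
  refine ⟨⟨perfPoly, fun X A m _ _ _ M π S hne => ⟨exists_isOptimalMixture M π, fun w _ => ?_⟩⟩,
    Polynomial.C 200 * Polynomial.X ^ 3, Polynomial.X, fun X A m _ _ _ M π S η T hne _ hT =>
      ⟨law_program M π hne η T, fun r hr => ?_⟩⟩
  · rw [eval_perfPoly]
    refine ⟨M.exists_isMinOn_dual π w _ hne, fun u η δ T hu hη hδ hδ1 hT => ?_, fun ε hε => ?_⟩
    · refine (M.dualSGD_performance_forall π hu hη hδ hδ1 hT).trans
        (MeasureTheory.measure_mono fun θhat hθhat θ h1 h2 => ?_)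
      have h3 : M.J (M.dualPolicy π θhat) ≤
          M.dualCost π θ + perfConst S m M.costBound * M.rate u := hθhat θ h1 h2
      rw [← M.J_add_dualGap π w h1] at h3
      linarith
    · -- `u` is the violation of a minimizer, perturbed because it may vanish
      obtain ⟨q, hq, hmin⟩ := M.exists_isMinOn_dual π w (perfConst S m M.costBound) hne
      obtain ⟨u, hu, hUu, hrate⟩ := M.exists_rate_le (perfConst S m M.costBound)
        (M.violation π q) ε (M.violation_nonneg π q) hε
      refine ⟨Real.sqrt ((1 - M.γ) * u), Real.sqrt_pos.2 (mul_pos M.one_sub_γ_pos hu),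
        fun δ T hδ hδ1 hT => ?_⟩
      refine (M.dualSGD_performance π hu rfl hδ hδ1 hT hq hUu).trans
        (MeasureTheory.measure_mono fun θhat hθhat θ h1 => ?_)
      have h3 : M.J (M.dualPolicy π θhat) ≤
          M.dualCost π q + perfConst S m M.costBound * M.rate u := hθhat
      have h4 : M.dualGap π w q + perfConst S m M.costBound * M.rate (M.violation π q) ≤
          M.dualGap π w θ + perfConst S m M.costBound * M.rate (M.violation π θ) := hmin h1
      rw [← M.J_add_dualGap π w hq] at h3
      linarith
  · simp only [Polynomial.eval_mul, Polynomial.eval_C, Polynomial.eval_pow, Polynomial.eval_X]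
    exact (stepsLe_program M π S η T r hr).trans
      (program_steps_le (NeZero.pos X) (NeZero.pos A) (NeZero.pos m) hT)
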